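/- Let $n\ge 0$ and let $V(n)=(\mathbb{C}[t]/t^n)^2$. Every $a\in V(n)$ is uniquely $\sum_{i=0}^{n-1}a_it^i$ with $a_i\in\mathbb{C}^2$; give $V(n)$ the Hermitian inner product $\langle\sum a_it^i,\sum b_it^i\rangle=\sum_i\langle a_i,b_i\rangle$, and let $\omega\colon V(n)\to\mathbb{C}^2$ be the linear map $\omega(\sum a_it^i)=\sum a_i$. Let $X(n)$ be the space of complete flags $0=W_0<W_1<\dots<W_{2n}=V(n)$ of $\mathbb{C}[t]$-submodules of $V(n)$, with the topology inherited from the product of the Grassmannians of $V(n)$. Let $\chi\colon\mathbb{CP}^1\to\mathbb{CP}^1$ be the antipodal map $\chi(L)=L^\perp$. Then for each $\underline{W}\in X(n)$ and $1\le i\le 2n$ the space $\overline{\omega}_i(\underline{W})=\omega(W_i\cap W_{i-1}^\perp)$ is a line in $\mathbb{C}^2$, and the resulting maps $\overline{\omega}_i\colon X(n)\to\mathbb{CP}^1$ have the following properties. (1) A subset $K\subseteq\{1,\dots,2n\}$ is sparse if for each $k\in K$ the set $\{k+1,\dots,2n\}$ has more elements outside $K$ than in $K$. A non-crossing matching is a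 permutation $\tau$ of $\{1,\dots,2n\}$ with $\tau^2=1$, $\tau(i)\ne i$ for all $i$, and no $i<j<\tau(i)<\tau(j)$; sparse sets $K$ of size $n$ correspond bijectively to non-crossing matchings $\tau$ by $K=\{i\mid i<\tau(i)\}$. For such $K$ and $\tau$ let $X'(n,K)=\{u\colon\{1,\dots,2n\}\to\mathbb{CP}^1\mid u(\tau(i))=\chi(u(i))\text{ for all }i\}$, and let $X'(n)=\bigcup_KX'(n,K)\subseteq(\mathbb{CP}^1)^{2n}$, where $K$ runs over the sparse sets of size $n$. Then $\underline{W}\mapsto(\overline{\omega}_i(\underline{W}))_i$ is a homeomorphism $X(n)\to X'(n)$. (2) Let $n>0$ and let $C(n)$ be the $2n$-gon: the graph with vertex set $\mathbb{Z}/2n$ and directed edges $e_i=(i-1,i)$ and $\overline{e}_i=(i,i-1)$, with the parity map $\mathbb{Z}/2n\to\mathbb{Z}/2$ on vertices. For a graph $G$ let $Y_1(G)$ be the space of maps $m$ from the set of directed edges of $G$ to $\mathbb{CP}^1$ with $m(\overline{e})=\chi(m(e))$ for every edge $e$, where $\overline{e}$ is the reversed edge. A tree folding $p\colon C(n)\to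 T$ is the quotient map to $T=C(n)/{\sim}$ (with edges the images of edges) for an equivalence relation $\sim$ on vertices such that equivalent vertices have the same parity and $T$ is a tree. Let $Y(C(n))\subseteq Y_1(C(n))$ be the union of the subspaces $p^*(Y_1(T))$ over all tree foldings $p\colon C(n)\to T$. Then there is a homeomorphism $\sigma\colon X(n)\to Y(C(n))$ given by $\sigma(\underline{W})(e_i)=\overline{\omega}_i(\underline{W})$ and $\sigma(\underline{W})(\overline{e}_i)=\chi(\overline{\omega}_i(\underline{W}))$. -/

import Mathlib

open Polynomial

open scoped LinearAlgebra.Projectivization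

noncomputable section

namespace KhovanovSpringer

/-! ### The projective line and the antipodal map -/

/-- `ℂ²` with its usual Hermitian inner product. -/
abbrev C2 : Type := EuclideanSpace ℂ (Fin 2)

/-- The complex projective line: lines through the origin in `ℂ²`. -/
abbrev CP1 : Type := ℙ ℂ C2

/-- `ℂP¹` carries the quotient topology from `ℂ² ∖ {0}`. -/
instance : TopologicalSpace CP1 :=
  inferInstanceAs (TopologicalSpace (Quotient (projectivizationSetoid ℂ C2)))

theorem finrank_orthogonal_line (L : CP1) : Module.finrank ℂ (L.submodule)ᗮ = 1 := by
  have h := L.submodule.finrank_add_finrank_orthogonal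
  rw [L.finrank_submodule, finrank_euclideanSpace_fin] at h
  omega

/-- The antipodal map `χ(L) = Lᗮ` on `ℂP¹`. -/
def chi (L : CP1) : CP1 :=
  Projectivization.mk'' (L.submodule)ᗮ (finrank_orthogonal_line L)

/-! ### The module `V(n) = (ℂ[t]/tⁿ)²`, its inner product and the map `ω` -/

/-- `V(n) = (ℂ[t]/tⁿ)²`. -/
def V (n : ℕ) : Type := Fin 2 → (ℂ[X] ⧸ Ideal.span {(X : ℂ[X]) ^ n})

instance (n : ℕ) : AddCommGroup (V n) :=
  inferInstanceAs (AddCommGroup (Fin 2 → (ℂ[X] ⧸ Ideal.span {(X : ℂ[X]) ^ n})))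

instance (n : ℕ) : Module ℂ[X] (V n) :=
  inferInstanceAs (Module ℂ[X] (Fin 2 → (ℂ[X] ⧸ Ideal.span {(X : ℂ[X]) ^ n})))

instance (n : ℕ) : Module ℂ (V n) :=
  inferInstanceAs (Module ℂ (Fin 2 → (ℂ[X] ⧸ Ideal.span {(X : ℂ[X]) ^ n})))

instance (n : ℕ) : IsScalarTower ℂ ℂ[X] (V n) :=
  inferInstanceAs (IsScalarTower ℂ ℂ[X] (Fin 2 → (ℂ[X] ⧸ Ideal.span {(X : ℂ[X]) ^ n})))

/-- The unique polynomial of degree `< n` representing a class in `ℂ[t]/tⁿ`. -/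
def reduced (n : ℕ) : (ℂ[X] ⧸ Ideal.span {(X : ℂ[X]) ^ n}) →ₗ[ℂ] ℂ[X] :=
  AdjoinRoot.modByMonicHom (monic_X_pow n)

theorem reduced_mk (n : ℕ) (f : ℂ[X]) :
    reduced n (Ideal.Quotient.mk _ f) = f %ₘ (X ^ n) :=
  AdjoinRoot.modByMonicHom_mk (monic_X_pow n) f

theorem mk_reduced (n : ℕ) (a : ℂ[X] ⧸ Ideal.span {(X : ℂ[X]) ^ n}) :
    Ideal.Quotient.mk _ (reduced n a) = a :=
  AdjoinRoot.mk_leftInverse (monic_X_pow n) a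

theorem degree_reduced_lt (n : ℕ) (a : ℂ[X] ⧸ Ideal.span {(X : ℂ[X]) ^ n}) :
    (reduced n a).degree < n := by
  obtain ⟨f, rfl⟩ := Ideal.Quotient.mk_surjective a
  rw [reduced_mk]
  simpa using degree_modByMonic_lt f (monic_X_pow (R := ℂ) n)

/-- The coefficient `aᵢ ∈ ℂ²` of `a = ∑ aᵢ tⁱ ∈ V(n)`. -/
def coeffVec {n : ℕ} (i : Fin n) (a : V n) : C2 :=
  WithLp.toLp 2 fun j => (reduced n (a j)).coeff i

theorem coeffVec_add {n : ℕ} (i : Fin n) (a b : V n) :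
    coeffVec i (a + b) = coeffVec i a + coeffVec i b := by
  ext j
  change (reduced n (a j + b j)).coeff i = _
  rw [map_add, coeff_add]
  rfl

theorem coeffVec_smul {n : ℕ} (i : Fin n) (c : ℂ) (a : V n) :
    coeffVec i (c • a) = c • coeffVec i a := by
  ext j
  change (reduced n (c • a j)).coeff i = _
  rw [map_smul, coeff_smul]
  rfl

theorem eq_zero_of_coeffVec {n : ℕ} (a : V n) (h : ∀ i : Fin n, coeffVec i a = 0) : a = 0 := by
  funext j
  have h0 : reduced n (a j) = 0 := by
    ext k
    by_cases hk : k < n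
    · exact congrArg (fun v : C2 => v j) (h ⟨k, hk⟩)
    · rw [coeff_zero]
      refine coeff_eq_zero_of_degree_lt (lt_of_lt_of_le (degree_reduced_lt n (a j)) ?_)
      exact_mod_cast not_lt.mp hk
  rw [← mk_reduced n (a j), h0, map_zero]
  rfl

/-- The Hermitian inner product `⟨∑ aᵢ tⁱ, ∑ bᵢ tⁱ⟩ = ∑ ⟨aᵢ, bᵢ⟩` on `V(n)` (conjugate-linear in the
first variable, as everywhere in Mathlib). -/
@[reducible] def innerCore (n : ℕ) : InnerProductSpace.Core ℂ (V n) where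
  inner a b := ∑ i : Fin n, inner ℂ (coeffVec i a) (coeffVec i b)
  conj_inner_symm a b := by simp [map_sum]
  re_inner_nonneg a := by
    rw [map_sum]
    exact Finset.sum_nonneg fun i _ => inner_self_nonneg
  add_left a b c := by simp [coeffVec_add, Finset.sum_add_distrib]
  smul_left a b c := by simp [coeffVec_smul, Finset.mul_sum, mul_comm]
  definite a h := by
    apply eq_zero_of_coeffVec
    have h' : ∑ i : Fin n, (‖coeffVec i a‖ ^ 2 : ℝ) = 0 := by
      have := congrArg Complex.re h
      simpa [inner_self_eq_norm_sq_to_K, ← Complex.ofReal_pow] using this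
    intro i
    have := (Finset.sum_eq_zero_iff_of_nonneg fun i _ => sq_nonneg _).mp h' i (Finset.mem_univ i)
    simpa using this

instance (n : ℕ) : NormedAddCommGroup (V n) := (innerCore n).toNormedAddCommGroup

instance (n : ℕ) : InnerProductSpace ℂ (V n) := InnerProductSpace.ofCore (innerCore n).toCore

instance (n : ℕ) : FiniteDimensional ℂ (V n) := by
  have : Module.Finite ℂ (ℂ[X] ⧸ Ideal.span {(X : ℂ[X]) ^ n}) :=
    (AdjoinRoot.powerBasis' (monic_X_pow (R := ℂ) n)).finite
  exact inferInstanceAs (Module.Finite ℂ (Fin 2 → (ℂ[X] ⧸ Ideal.span {(X : ℂ[X]) ^ n})))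

/-- The linear map `ω(∑ aᵢ tⁱ) = ∑ aᵢ` from `V(n)` to `ℂ²`. -/
def omega (n : ℕ) : V n →ₗ[ℂ] C2 where
  toFun a := ∑ i : Fin n, coeffVec i a
  map_add' a b := by simp [coeffVec_add, Finset.sum_add_distrib]
  map_smul' c a := by simp [coeffVec_smul, Finset.smul_sum]

/-! ### The Khovanov–Springer variety `X(n)` -/

/-- `X(n)`: the complete flags `0 = W₀ < W₁ < ⋯ < W₂ₙ = V(n)` of `ℂ[t]`-submodules of `V(n)`. -/
def FlagVariety (n : ℕ) : Type :=
  {W : Fin (2 * n + 1) → Submodule ℂ[X] (V n) //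
    W 0 = ⊥ ∧ W (Fin.last (2 * n)) = ⊤ ∧ ∀ i : Fin (2 * n), W i.castSucc < W i.succ}

/-- The `i`-th term of a flag, as a complex subspace of `V(n)`. -/
def FlagVariety.subspace {n : ℕ} (W : FlagVariety n) (i : Fin (2 * n + 1)) : Submodule ℂ (V n) :=
  (W.1 i).restrictScalars ℂ

/-- The usual (classical) topology on `X(n)`, as a subspace of a product of Grassmannians, where
Grassmannians are topologised by identifying a subspace with the orthogonal projection onto it. -/
instance (n : ℕ) : TopologicalSpace (FlagVariety n) :=
  TopologicalSpace.induced
    (fun W => fun i : Fin (2 * n + 1) => ((W.subspace i).starProjection : V n →L[ℂ] V n))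
    inferInstance

/-- The subspace `ω(Wᵢ ⊖ Wᵢ₋₁)` of `ℂ²`. The index `i : Fin (2 * n)` stands for `i + 1` in
`{1, …, 2n}`. -/
def omegaLine {n : ℕ} (W : FlagVariety n) (i : Fin (2 * n)) : Submodule ℂ C2 :=
  (W.subspace i.succ ⊓ (W.subspace i.castSucc)ᗮ).map (omega n)

/-! ### Sparse sets, non-crossing matchings and the spaces `X'(n,K)` -/

/-- `J` is sparse if for each `j ∈ J` more elements above `j` lie outside `J` than in `J`. -/
def IsSparse {m : ℕ} (J : Finset (Fin m)) : Prop :=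
  ∀ j ∈ J, (J.filter (j < ·)).card < (Jᶜ.filter (j < ·)).card

/-- Non-crossing matchings: fixed-point-free involutions without `i < j < τ i < τ j`. -/
def IsNonCrossingMatching {m : ℕ} (τ : Equiv.Perm (Fin m)) : Prop :=
  (∀ i, τ (τ i) = i) ∧ (∀ i, τ i ≠ i) ∧ ¬ ∃ i j, i < j ∧ j < τ i ∧ τ i < τ j

/-- The space `X'(n,K)` of maps `u : {1, …, 2n} → ℂP¹` with `u (τ i) = χ (u i)`, where `τ` is the
non-crossing matching corresponding to `K`, i.e. the one with `K = {i | i < τ i}`. -/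
def XPrimeOf (n : ℕ) (K : Finset (Fin (2 * n))) : Set (Fin (2 * n) → CP1) :=
  {u | ∃ τ : Equiv.Perm (Fin (2 * n)), IsNonCrossingMatching τ ∧ (∀ i, i ∈ K ↔ i < τ i) ∧
    ∀ i, u (τ i) = chi (u i)}

/-- `X'(n)`: the union of the `X'(n,K)` over all sparse sets `K` of size `n`. -/
def XPrime (n : ℕ) : Set (Fin (2 * n) → CP1) :=
  ⋃ K ∈ {K : Finset (Fin (2 * n)) | IsSparse K ∧ K.card = n}, XPrimeOf n K

/-! ### Graphs, tree foldings and the space `Y(G)` -/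

/-- A connected graph on the vertex set `A` together with a parity map, i.e. a morphism to the
complete graph on two vertices. Directed edges are the darts `graph.Dart`, and edge reversal is
`SimpleGraph.Dart.symm`. -/
structure ParityGraph (A : Type*) where
  graph : SimpleGraph A
  connected : graph.Connected
  parity : graph.Coloring (ZMod 2)

/-- `Y₁(G)`: the `ℂP¹`-labellings `m` of directed edges such that reversing an edge changes its
label by `χ`. -/
def Y1 {A : Type*} (G : SimpleGraph A) : Set (G.Dart → CP1) :=
  {m | ∀ e, m e.symm = chi (m e)}

/-- An equivalence relation on the vertices is foldable if equivalent vertices have equal parity. -/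
def ParityGraph.Foldable {A : Type*} (G : ParityGraph A) (s : Setoid A) : Prop :=
  ∀ u v, s u v → G.parity u = G.parity v

/-- The quotient graph of `G` by an equivalence relation: the edges are the images of edges. -/
def ParityGraph.quotient {A : Type*} (G : ParityGraph A) (s : Setoid A) :
    SimpleGraph (Quotient s) :=
  G.graph.map (Quotient.mk s)

/-- The folding `G → G/∼` of a foldable equivalence relation. -/
def ParityGraph.folding {A : Type*} (G : ParityGraph A) (s : Setoid A) (hs : G.Foldable s) :
    G.graph →g G.quotient s :=
  SimpleGraph.Hom.map (Quotient.mk s) G.graph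
    fun {u v} h huv => G.parity.valid h (hs u v (Quotient.exact huv))

/-- `Y(G)`: the union, over all tree foldings `p : G → T`, of the subspaces `p^*(Y₁(T))` of
`Y₁(G)`. -/
def Y {A : Type*} (G : ParityGraph A) : Set (G.graph.Dart → CP1) :=
  {m | ∃ (s : Setoid A) (hs : G.Foldable s), (G.quotient s).IsTree ∧
    ∃ m' ∈ Y1 (G.quotient s), m = fun e => m' ((G.folding s hs).mapDart e)}

/-! ### The `2n`-gon -/

/-- The parity `ℤ/2n → ℤ/2`. -/
def polygonParity (n : ℕ) : ZMod (2 * n) →+* ZMod 2 :=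
  ZMod.castHom (dvd_mul_right 2 n) (ZMod 2)

theorem polygonParity_succ_ne (n : ℕ) (i : ZMod (2 * n)) :
    polygonParity n (i + 1) ≠ polygonParity n i := by
  rw [map_add, map_one]
  simp

/-- The underlying graph of the `2n`-gon: vertices `ℤ/2n`, edges `(i, i + 1)` and `(i + 1, i)`. -/
def polygonGraph (n : ℕ) : SimpleGraph (ZMod (2 * n)) where
  Adj i j := j = i + 1 ∨ i = j + 1
  symm := ⟨fun _ _ h => h.symm⟩
  loopless := ⟨fun i h =>
    polygonParity_succ_ne n i (congrArg (polygonParity n) (h.elim Eq.symm Eq.symm))⟩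

theorem polygonGraph_connected (n : ℕ) : (polygonGraph n).Connected := by
  have key : ∀ k : ℤ, (polygonGraph n).Reachable 0 (k : ZMod (2 * n)) := by
    intro k
    induction k using Int.induction_on with
    | zero => simp
    | succ k ih =>
      refine ih.trans (SimpleGraph.Adj.reachable (Or.inl ?_))
      push_cast
      ring
    | pred k ih =>
      refine ih.trans (SimpleGraph.Adj.reachable (Or.inr ?_))
      push_cast
      ring
  have : Nonempty (ZMod (2 * n)) := ⟨0⟩
  refine SimpleGraph.Connected.mk fun u v => ?_
  obtain ⟨a, rfl⟩ := ZMod.intCast_surjective u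
  obtain ⟨b, rfl⟩ := ZMod.intCast_surjective v
  exact (key a).symm.trans (key b)

/-- The `2n`-gon `C(n)`, for `n > 0`. -/
def polygon (n : ℕ) : ParityGraph (ZMod (2 * n)) where
  graph := polygonGraph n
  connected := polygonGraph_connected n
  parity := SimpleGraph.Coloring.mk (polygonParity n) fun {u v} h => by
    rcases h with rfl | rfl
    · exact (polygonParity_succ_ne n u).symm
    · exact polygonParity_succ_ne n v

/-- The directed edge `eᵢ = (i - 1, i)` of `C(n)`. The index `i : Fin (2 * n)` stands for `i + 1` in
`{1, …, 2n}`. -/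
def polygonEdge (n : ℕ) (i : Fin (2 * n)) : (polygon n).graph.Dart :=
  ⟨((i : ℕ), (i : ℕ) + 1), Or.inl rfl⟩

end KhovanovSpringer

end

open Polynomial

open scoped LinearAlgebra.Projectivization

noncomputable section

namespace KhovanovSpringer

/-! ### The infinite tail module -/

/-! All the `V n` sit in one space `Tail` on which t is the backward shift: it is locally nilpotent
and surjective, its kernel is a copy of ℂ², and `V n` becomes the kernel of tⁿ. The inner product
and ω extend to `Tail`, ω as `total`.

The heart is the identity ⟨ω a, ω b⟩ = ⟨a, b⟩ + ∑ₖ (⟨tᵏ⁺¹a, b⟩ + ⟨a, tᵏ⁺¹b⟩) (`inner_total_total`).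
If W is t-stable and finite-dimensional and a, b lie in t⁻¹W ∩ Wᗮ, all correction terms vanish, so ω
maps this plane isometrically onto ℂ². A t-stable extension of W by one dimension lies in t⁻¹W,
because t is nilpotent on each vector. Such extensions therefore correspond to lines in ℂ², and
partial flags starting at 0 correspond to words in `CP1`. It remains to say which words of length 2n
end at the kernel of tⁿ.

Extending by L and then by Lᗮ gives t⁻¹W (`next_next_orthogonal`), and extension commutes with t⁻¹
(`next_preimage`). Deleting an adjacent antipodal pair thus strips one t⁻¹ from the final subspace.
Conversely, a word whose subspace contains ker t has such a pair (`exists_cancelStep`). So flags in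
`V n` are the words of length 2n that cancel to the empty word.

Cancelling words, words with an antipodal non-crossing matching and tree-foldable labellings are
identified in a circle. Undoing cancellations inserts adjacent matched pairs and builds a matching.
A matching glues the polygon to a tree, whose vertices are the sets of arcs covering a vertex
(`isTree_coveringSetoid`). The boundary of the polygon then becomes a closed walk in a tree, and its
word cancels (`walk_cancels`).

For the topology, the lines depend continuously on the flag, `FlagVariety n` is compact and `CP1` is
Hausdorff, so the continuous bijection is a homeomorphism. -/

/-- Finitely supported sequences in `ℂ²`: the union of all `V(n)`, where `V(n)` is embedded in
`V(n + 1)` by multiplication by `t`. -/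
def Tail : Type := ℕ →₀ C2

namespace Tail

instance : AddCommGroup Tail := inferInstanceAs (AddCommGroup (ℕ →₀ C2))

instance : Module ℂ Tail := inferInstanceAs (Module ℂ (ℕ →₀ C2))

/-- The `i`-th coordinate. -/
def coord (i : ℕ) : Tail →ₗ[ℂ] C2 := Finsupp.lapply i

theorem ext_coord {a b : Tail} (h : ∀ i, coord i a = coord i b) : a = b := Finsupp.ext h

theorem exists_coord_eq_zero (a : Tail) : ∃ N, ∀ i, N ≤ i → coord i a = 0 := by
  classical
  obtain ⟨N, hN⟩ := (Finsupp.support (a : ℕ →₀ C2)).exists_nat_subset_range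
  refine ⟨N, fun i hi => ?_⟩
  by_contra h
  have := hN (Finsupp.mem_support_iff.mpr h)
  simp only [Finset.mem_range] at this
  omega

/-- The sum of all coordinates. -/
def total : Tail →ₗ[ℂ] C2 := Finsupp.lsum ℂ fun _ => LinearMap.id

theorem total_eq_sum (a : Tail) {N : ℕ} (h : ∀ i, N ≤ i → coord i a = 0) :
    total a = ∑ i ∈ Finset.range N, coord i a := by
  refine Finsupp.sum_of_support_subset (a : ℕ →₀ C2) ?_ _ (by simp)
  intro i hi
  by_contra hN
  exact Finsupp.mem_support_iff.mp hi (h i (by simpa using hN))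

/-- The sum of the inner products of the coordinates. -/
def pairing (a b : Tail) : ℂ := Finsupp.sum (a : ℕ →₀ C2) fun i x => inner ℂ x (coord i b)

theorem pairing_eq_sum (a b : Tail) {N : ℕ} (h : ∀ i, N ≤ i → coord i a = 0) :
    pairing a b = ∑ i ∈ Finset.range N, inner ℂ (coord i a) (coord i b) := by
  refine Finsupp.sum_of_support_subset (a : ℕ →₀ C2) ?_ _ (by simp)
  intro i hi
  by_contra hN
  exact Finsupp.mem_support_iff.mp hi (h i (by simpa using hN))

/-- The Hermitian inner product on the tail module. -/
@[reducible] def innerCore : InnerProductSpace.Core ℂ Tail where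
  inner := pairing
  conj_inner_symm a b := by
    obtain ⟨N, hN⟩ := exists_coord_eq_zero a
    obtain ⟨M, hM⟩ := exists_coord_eq_zero b
    rw [pairing_eq_sum a b (N := max N M) fun i hi => hN i (by omega),
      pairing_eq_sum b a (N := max N M) fun i hi => hM i (by omega)]
    simp [map_sum]
  re_inner_nonneg a := by
    obtain ⟨N, hN⟩ := exists_coord_eq_zero a
    rw [pairing_eq_sum a a hN, map_sum]
    exact Finset.sum_nonneg fun i _ => inner_self_nonneg
  add_left a b c := by
    obtain ⟨N, hN⟩ := exists_coord_eq_zero a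
    obtain ⟨M, hM⟩ := exists_coord_eq_zero b
    rw [pairing_eq_sum a c (N := max N M) fun i hi => hN i (by omega),
      pairing_eq_sum b c (N := max N M) fun i hi => hM i (by omega),
      pairing_eq_sum (a + b) c (N := max N M) fun i hi => by
        rw [map_add, hN i (by omega), hM i (by omega), add_zero]]
    simp [Finset.sum_add_distrib]
  smul_left a b c := by
    obtain ⟨N, hN⟩ := exists_coord_eq_zero a
    rw [pairing_eq_sum a b hN,
      pairing_eq_sum (c • a) b (N := N) fun i hi => by rw [map_smul, hN i hi, smul_zero]]
    simp [Finset.mul_sum, mul_comm]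
  definite a h := by
    obtain ⟨N, hN⟩ := exists_coord_eq_zero a
    rw [pairing_eq_sum a a hN] at h
    have h' : ∑ i ∈ Finset.range N, (‖coord i a‖ ^ 2 : ℝ) = 0 := by
      have := congrArg Complex.re h
      simpa [inner_self_eq_norm_sq_to_K, ← Complex.ofReal_pow] using this
    refine ext_coord fun i => ?_
    rw [map_zero]
    by_cases hi : i < N
    · have := (Finset.sum_eq_zero_iff_of_nonneg fun i _ => sq_nonneg _).mp h' i (by simpa using hi)
      simpa using this
    · exact hN i (not_lt.mp hi)

instance : NormedAddCommGroup Tail := innerCore.toNormedAddCommGroup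

instance : InnerProductSpace ℂ Tail := InnerProductSpace.ofCore innerCore.toCore

theorem inner_eq_sum (a b : Tail) {N : ℕ} (h : ∀ i, N ≤ i → coord i a = 0) :
    inner ℂ a b = ∑ i ∈ Finset.range N, inner ℂ (coord i a) (coord i b) :=
  pairing_eq_sum a b h

/-- Multiplication by `t`: the backward shift. -/
def shift : Tail →ₗ[ℂ] Tail :=
  Finsupp.lcomapDomain (fun i : ℕ => i + 1) (add_left_injective 1)

@[simp] theorem coord_shift (i : ℕ) (a : Tail) : coord i (shift a) = coord (i + 1) a := rfl

theorem coord_shift_pow (k i : ℕ) (a : Tail) : coord i ((shift ^ k) a) = coord (i + k) a := by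
  induction k generalizing i with
  | zero => rfl
  | succ k ih => rw [pow_succ', Module.End.mul_apply, coord_shift, ih]; congr 2; omega

/-- The element concentrated in degree zero. -/
def constant : C2 →ₗ[ℂ] Tail := Finsupp.lsingle 0

@[simp] theorem coord_zero_constant (x : C2) : coord 0 (constant x) = x := Finsupp.single_eq_same

@[simp] theorem shift_constant (x : C2) : shift (constant x) = 0 :=
  ext_coord fun i => Finsupp.single_eq_of_ne (Nat.succ_ne_zero i)

theorem inner_constant (x : C2) (a : Tail) : inner ℂ (constant x) a = inner ℂ x (coord 0 a) := by
  rw [inner_eq_sum (N := 1)]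
  · simp
  · intro i hi
    exact Finsupp.single_eq_of_ne (by omega)

theorem ker_shift : LinearMap.ker shift = LinearMap.range constant := by
  ext a
  rw [LinearMap.mem_ker, LinearMap.mem_range]
  constructor
  · intro h
    refine ⟨coord 0 a, ext_coord fun i => ?_⟩
    rcases i with _ | i
    · simp
    · rw [← coord_shift, ← coord_shift, h, shift_constant]
  · rintro ⟨x, rfl⟩
    exact shift_constant x

theorem finrank_ker_shift : Module.finrank ℂ (LinearMap.ker shift) = 2 := by
  rw [ker_shift, LinearMap.finrank_range_of_inj, finrank_euclideanSpace_fin]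
  intro x y h
  simpa using congrArg (coord 0) h

instance : FiniteDimensional ℂ (LinearMap.ker shift) := by
  rw [ker_shift]; infer_instance

theorem shift_surjective : Function.Surjective shift := by
  intro a
  refine ⟨(Finsupp.mapDomain (fun i : ℕ => i + 1) a : ℕ →₀ C2), ext_coord fun i => ?_⟩
  exact Finsupp.mapDomain_apply (add_left_injective 1) (a : ℕ →₀ C2) i

theorem exists_shift_pow_eq_zero (a : Tail) : ∃ N, (shift ^ N) a = 0 := by
  obtain ⟨N, hN⟩ := exists_coord_eq_zero a
  refine ⟨N, ext_coord fun i => ?_⟩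
  rw [coord_shift_pow, hN _ (by omega), map_zero]

/-! ### The identity comparing `total` with the inner product. -/

theorem inner_shift_shift (a b : Tail) :
    inner ℂ (shift a) (shift b) = inner ℂ a b - inner ℂ (coord 0 a) (coord 0 b) := by
  obtain ⟨N, hN⟩ := exists_coord_eq_zero a
  rw [inner_eq_sum a b (N := N + 1) fun i hi => hN i (by omega),
    inner_eq_sum (shift a) (shift b) (N := N) fun i hi => hN (i + 1) (by omega),
    Finset.sum_range_succ']
  simp

theorem total_shift (a : Tail) : total (shift a) = total a - coord 0 a := by
  obtain ⟨N, hN⟩ := exists_coord_eq_zero a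
  rw [total_eq_sum a (N := N + 1) fun i hi => hN i (by omega),
    total_eq_sum (shift a) (N := N) fun i hi => hN (i + 1) (by omega), Finset.sum_range_succ']
  simp

theorem total_eq_sum_coord_zero (N : ℕ) (a : Tail) (h : (shift ^ N) a = 0) :
    total a = ∑ k ∈ Finset.range N, coord 0 ((shift ^ k) a) := by
  rw [total_eq_sum a (N := N)]
  · refine Finset.sum_congr rfl fun k _ => ?_
    rw [coord_shift_pow, zero_add]
  · intro i hi
    have := congrArg (coord (i - N)) h
    rwa [coord_shift_pow, Nat.sub_add_cancel hi, map_zero] at this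

/-- The left side is the double sum of all ⟨aᵢ, bⱼ⟩. Grouped by i - j, the main diagonal gives ⟨a,
b⟩ and the diagonals at distance k + 1 give the two shifted terms. The induction replaces a, b by
ta, tb, which removes the row and column of index 0. -/
theorem inner_total_total (N : ℕ) (a b : Tail) (ha : (shift ^ N) a = 0) (hb : (shift ^ N) b = 0) :
    inner ℂ (total a) (total b) = inner ℂ a b + ∑ k ∈ Finset.range N,
      (inner ℂ ((shift ^ (k + 1)) a) b + inner ℂ a ((shift ^ (k + 1)) b)) := by
  induction N generalizing a b with
  | zero =>
    have ha : a = 0 := ha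
    simp [ha]
  | succ N ih =>
    have e : ∀ (k : ℕ) (c : Tail), (shift ^ k) (shift c) = (shift ^ (k + 1)) c := fun k c => by
      rw [pow_succ, Module.End.mul_apply]
    have e' : ∀ (k : ℕ) (c : Tail), shift ((shift ^ k) c) = (shift ^ (k + 1)) c := fun k c => by
      rw [pow_succ', Module.End.mul_apply]
    have hta : (shift ^ N) (shift a) = 0 := by rw [e, ha]
    have htb : (shift ^ N) (shift b) = 0 := by rw [e, hb]
    have key := ih (shift a) (shift b) hta htb
    have sa := total_eq_sum_coord_zero N (shift a) hta
    have sb := total_eq_sum_coord_zero N (shift b) htb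
    have ea : total a = total (shift a) + coord 0 a := by rw [total_shift]; abel
    have eb : total b = total (shift b) + coord 0 b := by rw [total_shift]; abel
    rw [Finset.sum_range_succ, ha, hb, ea, eb, inner_add_left, inner_add_right, inner_add_right,
      key, inner_shift_shift]
    have h1 : ∀ k, inner ℂ ((shift ^ (k + 1)) (shift a)) (shift b) =
        inner ℂ ((shift ^ (k + 1)) a) b -
          inner ℂ (coord 0 ((shift ^ k) (shift a))) (coord 0 b) := by
      intro k
      rw [e, e, ← e', inner_shift_shift]
    have h2 : ∀ k, inner ℂ (shift a) ((shift ^ (k + 1)) (shift b)) =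
        inner ℂ a ((shift ^ (k + 1)) b) -
          inner ℂ (coord 0 a) (coord 0 ((shift ^ k) (shift b))) := by
      intro k
      rw [e, e, ← e', inner_shift_shift]
    simp only [h1, h2, Finset.sum_add_distrib, Finset.sum_sub_distrib]
    rw [← sum_inner _ _ (coord 0 b), ← inner_sum _ _ (coord 0 a), ← sa, ← sb, inner_zero_left,
      inner_zero_right]
    ring

end Tail

/-! ### One-step extensions of shift-stable subspaces -/

theorem finrank_map_add_finrank_inf_ker {E F : Type*} [AddCommGroup E] [Module ℂ E]
    [AddCommGroup F] [Module ℂ F] (f : E →ₗ[ℂ] F) (U : Submodule ℂ E) [FiniteDimensional ℂ U] :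
    Module.finrank ℂ (U.map f) + Module.finrank ℂ (U ⊓ LinearMap.ker f : Submodule ℂ E) =
      Module.finrank ℂ U := by
  rw [← (f.domRestrict U).finrank_range_add_finrank_ker, LinearMap.range_domRestrict]
  congr 1
  rw [LinearMap.ker_domRestrict, ← Submodule.finrank_map_subtype_eq, Submodule.map_comap_subtype]

namespace Tail

/-- The subspace `t⁻¹W`. -/
def preimage (W : Submodule ℂ Tail) : Submodule ℂ Tail := W.comap shift

theorem mem_preimage {W : Submodule ℂ Tail} {a : Tail} : a ∈ preimage W ↔ shift a ∈ W := Iff.rfl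

theorem preimage_injective : Function.Injective preimage :=
  Submodule.comap_injective_of_surjective shift_surjective

theorem ker_le_preimage (W : Submodule ℂ Tail) : LinearMap.ker shift ≤ preimage W := by
  intro a ha
  rw [mem_preimage, LinearMap.mem_ker.mp ha]
  exact W.zero_mem

instance (W : Submodule ℂ Tail) [FiniteDimensional ℂ W] : FiniteDimensional ℂ (preimage W) := by
  rw [← Submodule.fg_iff_finiteDimensional]
  refine Submodule.fg_of_fg_map_of_fg_inf_ker shift ?_ ?_
  · rw [preimage, Submodule.map_comap_eq_of_surjective shift_surjective]
    exact Submodule.fg_iff_finiteDimensional _ |>.mpr inferInstance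
  · rw [inf_eq_right.mpr (ker_le_preimage W)]
    exact Submodule.fg_iff_finiteDimensional _ |>.mpr inferInstance

theorem finrank_preimage (W : Submodule ℂ Tail) [FiniteDimensional ℂ W] :
    Module.finrank ℂ (preimage W) = Module.finrank ℂ W + 2 := by
  have h := finrank_map_add_finrank_inf_ker shift (preimage W)
  rw [inf_eq_right.mpr (ker_le_preimage W), finrank_ker_shift, preimage,
    Submodule.map_comap_eq_of_surjective shift_surjective] at h
  exact h.symm

/-- The orthogonal complement of `W` in `t⁻¹W`. -/
def gap (W : Submodule ℂ Tail) : Submodule ℂ Tail := preimage W ⊓ Wᗮ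

theorem shift_pow_succ_mem {W : Submodule ℂ Tail} (hW : W ≤ preimage W) {a : Tail}
    (ha : a ∈ preimage W) (k : ℕ) : (shift ^ (k + 1)) a ∈ W := by
  induction k with
  | zero => simpa using mem_preimage.mp ha
  | succ k ih => rw [pow_succ', Module.End.mul_apply]; exact hW ih

/-- Positive powers of t send a and b into W, to which both are orthogonal, so every correction term
in `inner_total_total` is zero. -/
theorem inner_total_of_mem_gap {W : Submodule ℂ Tail} (hW : W ≤ preimage W) {a b : Tail}
    (ha : a ∈ gap W) (hb : b ∈ gap W) : inner ℂ (total a) (total b) = inner ℂ a b := by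
  obtain ⟨N, hN⟩ := exists_shift_pow_eq_zero a
  obtain ⟨M, hM⟩ := exists_shift_pow_eq_zero b
  rw [inner_total_total (N + M) a b, Finset.sum_eq_zero, add_zero]
  · intro k _
    rw [hb.2 _ (shift_pow_succ_mem hW ha.1 k), Submodule.inner_left_of_mem_orthogonal
      (shift_pow_succ_mem hW hb.1 k) ha.2, add_zero]
  · rw [add_comm, pow_add, Module.End.mul_apply, hN, map_zero]
  · rw [pow_add, Module.End.mul_apply, hM, map_zero]

theorem eq_zero_of_mem_gap {W : Submodule ℂ Tail} (hW : W ≤ preimage W) {a : Tail}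
    (ha : a ∈ gap W) (h : total a = 0) : a = 0 := by
  have := inner_total_of_mem_gap hW ha ha
  rw [h, inner_zero_left] at this
  exact inner_self_eq_zero.mp this.symm

instance (W : Submodule ℂ Tail) [FiniteDimensional ℂ W] : FiniteDimensional ℂ (gap W) :=
  Submodule.finiteDimensional_of_le (inf_le_left : gap W ≤ preimage W)

theorem finrank_gap {W : Submodule ℂ Tail} [FiniteDimensional ℂ W] (hW : W ≤ preimage W) :
    Module.finrank ℂ (gap W) = 2 := by
  have h := Submodule.finrank_add_inf_finrank_orthogonal hW
  rw [finrank_preimage, inf_comm] at h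
  exact Nat.add_left_cancel h

/-- An isometry is injective, and both sides have dimension 2. -/
theorem map_total_gap {W : Submodule ℂ Tail} [FiniteDimensional ℂ W] (hW : W ≤ preimage W) :
    (gap W).map total = ⊤ := by
  apply Submodule.eq_top_of_finrank_eq
  have h := finrank_map_add_finrank_inf_ker total (gap W)
  have h0 : gap W ⊓ LinearMap.ker total = ⊥ :=
    (Submodule.eq_bot_iff _).mpr fun a ha => eq_zero_of_mem_gap hW ha.1 ha.2
  rw [h0, finrank_bot, add_zero, finrank_gap hW] at h
  rw [h, finrank_euclideanSpace_fin]

/-- The part of the gap lying over `L ⊆ ℂ²`. -/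
def gapOver (W : Submodule ℂ Tail) (L : Submodule ℂ C2) : Submodule ℂ Tail :=
  gap W ⊓ L.comap total

instance (W : Submodule ℂ Tail) [FiniteDimensional ℂ W] (L : Submodule ℂ C2) :
    FiniteDimensional ℂ (gapOver W L) :=
  Submodule.finiteDimensional_of_le (inf_le_left : gapOver W L ≤ gap W)

theorem map_total_gapOver {W : Submodule ℂ Tail} [FiniteDimensional ℂ W] (hW : W ≤ preimage W)
    (L : Submodule ℂ C2) : (gapOver W L).map total = L := by
  apply le_antisymm
  · rintro _ ⟨a, ha, rfl⟩
    exact ha.2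
  · intro x hx
    have hx' : x ∈ (gap W).map total := map_total_gap hW ▸ Submodule.mem_top
    obtain ⟨a, ha, rfl⟩ := hx'
    exact ⟨a, ⟨ha, hx⟩, rfl⟩

theorem finrank_gapOver {W : Submodule ℂ Tail} [FiniteDimensional ℂ W] (hW : W ≤ preimage W)
    (L : Submodule ℂ C2) : Module.finrank ℂ (gapOver W L) = Module.finrank ℂ L := by
  have h := finrank_map_add_finrank_inf_ker total (gapOver W L)
  have h0 : gapOver W L ⊓ LinearMap.ker total = ⊥ :=
    (Submodule.eq_bot_iff _).mpr fun a ha => eq_zero_of_mem_gap hW ha.1.1 ha.2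
  rw [h0, finrank_bot, add_zero, map_total_gapOver hW] at h
  exact h.symm

/-- The extension of `W` inside `t⁻¹W` in the direction of `L`. -/
def next (W : Submodule ℂ Tail) (L : Submodule ℂ C2) : Submodule ℂ Tail := W ⊔ gapOver W L

instance (W : Submodule ℂ Tail) [FiniteDimensional ℂ W] (L : Submodule ℂ C2) :
    FiniteDimensional ℂ (next W L) :=
  inferInstanceAs (FiniteDimensional ℂ (W ⊔ gapOver W L : Submodule ℂ Tail))

theorem le_next (W : Submodule ℂ Tail) (L : Submodule ℂ C2) : W ≤ next W L := le_sup_left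

theorem next_le_preimage {W : Submodule ℂ Tail} (hW : W ≤ preimage W) (L : Submodule ℂ C2) :
    next W L ≤ preimage W :=
  sup_le hW (inf_le_left.trans inf_le_left)

theorem preimage_mono {W W' : Submodule ℂ Tail} (h : W ≤ W') : preimage W ≤ preimage W' :=
  Submodule.comap_mono h

theorem next_le_preimage_next {W : Submodule ℂ Tail} (hW : W ≤ preimage W) (L : Submodule ℂ C2) :
    next W L ≤ preimage (next W L) :=
  (next_le_preimage hW L).trans (preimage_mono (le_next W L))

theorem next_inf_orthogonal (W : Submodule ℂ Tail) (L : Submodule ℂ C2) :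
    next W L ⊓ Wᗮ = gapOver W L := by
  have h : gapOver W L ≤ Wᗮ := inf_le_left.trans inf_le_right
  rw [next, sup_comm, sup_inf_assoc_of_le _ h, Submodule.inf_orthogonal_eq_bot, sup_bot_eq]

theorem finrank_next {W : Submodule ℂ Tail} [FiniteDimensional ℂ W] (hW : W ≤ preimage W)
    (L : Submodule ℂ C2) :
    Module.finrank ℂ (next W L) = Module.finrank ℂ W + Module.finrank ℂ L := by
  have h := Submodule.finrank_add_inf_finrank_orthogonal (le_next W L)
  rw [inf_comm, next_inf_orthogonal, finrank_gapOver hW] at h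
  exact h.symm

theorem map_total_next {W : Submodule ℂ Tail} [FiniteDimensional ℂ W] (hW : W ≤ preimage W)
    (L : Submodule ℂ C2) : (next W L ⊓ Wᗮ).map total = L := by
  rw [next_inf_orthogonal, map_total_gapOver hW]

theorem next_injective {W : Submodule ℂ Tail} [FiniteDimensional ℂ W] (hW : W ≤ preimage W) :
    Function.Injective (next W) := fun L M h => by
  rw [← map_total_next hW L, ← map_total_next hW M, h]

/-- Extending in two orthogonal directions fills `t⁻¹W`. -/
theorem next_next_orthogonal {W : Submodule ℂ Tail} [FiniteDimensional ℂ W] (hW : W ≤ preimage W)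
    (L : Submodule ℂ C2) : next (next W L) Lᗮ = preimage W := by
  symm
  apply Submodule.eq_of_le_of_finrank_eq
  · intro a ha
    have hdec : a ∈ W ⊔ gap W := by
      rw [gap, inf_comm, Submodule.sup_orthogonal_inf_of_hasOrthogonalProjection hW]
      exact ha
    obtain ⟨w, hw, q, hq, rfl⟩ := Submodule.mem_sup.mp hdec
    refine Submodule.add_mem _ (le_next _ _ (le_next _ _ hw)) ?_
    -- Split `total q` along L ⊕ Lᗮ and lift both parts to the gap; injectivity of `total` there
    -- makes q the sum of the lifts.
    obtain ⟨l, hl, l', hl', hll⟩ := L.exists_add_mem_mem_orthogonal (total q)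
    rw [← map_total_gapOver hW L] at hl
    rw [← map_total_gapOver hW Lᗮ] at hl'
    obtain ⟨q₁, hq₁, rfl⟩ := hl
    obtain ⟨q₂, hq₂, rfl⟩ := hl'
    have hqq : q = q₁ + q₂ := by
      rw [← sub_eq_zero]
      refine eq_zero_of_mem_gap hW (Submodule.sub_mem _ hq (Submodule.add_mem _ hq₁.1 hq₂.1)) ?_
      rw [map_sub, map_add, hll, sub_self]
    rw [hqq]
    refine Submodule.add_mem _ (le_next _ _ (Submodule.mem_sup_right hq₁))
      (Submodule.mem_sup_right ⟨⟨preimage_mono (le_next W L) hq₂.1.1, ?_⟩, hq₂.2⟩)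
    -- Orthogonality to `gapOver W L` is checked after applying `total`, where it is L ⟂ Lᗮ.
    rw [next, ← Submodule.inf_orthogonal]
    refine ⟨hq₂.1.2, fun q hq => ?_⟩
    rw [← inner_total_of_mem_gap hW hq.1 hq₂.1]
    exact hq₂.2 _ hq.2
  · have := L.finrank_add_finrank_orthogonal
    rw [finrank_euclideanSpace_fin] at this
    rw [finrank_preimage, finrank_next (next_le_preimage_next hW L), finrank_next hW]
    omega

/-- The kernel of t consists of the constants, which detect the zeroth coordinate. Once that
coordinate of a vanishes, t preserves `total a` and all inner products with a; this is what lets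
extensions commute with t⁻¹. -/
theorem coord_zero_eq_zero_of_mem_orthogonal {W : Submodule ℂ Tail}
    (h : LinearMap.ker shift ≤ W) {a : Tail} (ha : a ∈ Wᗮ) : coord 0 a = 0 := by
  have := ha (constant (coord 0 a)) (h (shift_constant _))
  rwa [inner_constant, inner_self_eq_zero] at this

/-- Extension commutes with taking preimages under `t`. -/
theorem next_preimage {W : Submodule ℂ Tail} [FiniteDimensional ℂ W] (hW : W ≤ preimage W)
    (L : Submodule ℂ C2) : next (preimage W) L = preimage (next W L) := by
  apply Submodule.eq_of_le_of_finrank_eq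
  · refine sup_le (preimage_mono (le_next W L)) ?_
    rintro q ⟨⟨hq, hq'⟩, hqL⟩
    have h0 := coord_zero_eq_zero_of_mem_orthogonal (ker_le_preimage W) hq'
    refine Submodule.mem_sup_right ⟨⟨hq, fun w hw => ?_⟩, ?_⟩
    · obtain ⟨w', rfl⟩ := shift_surjective w
      rw [inner_shift_shift, h0, inner_zero_right, sub_zero]
      exact hq' w' hw
    · change total (shift q) ∈ L
      rw [total_shift, h0, sub_zero]
      exact hqL
  · rw [finrank_next (preimage_mono hW), finrank_preimage, finrank_preimage, finrank_next hW]
    omega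

/-- A codimension-one extension of shift-stable subspaces is contained in the preimage. -/
theorem le_preimage_of_finrank {W W' : Submodule ℂ Tail} [FiniteDimensional ℂ W']
    (hW : W ≤ preimage W) (hW' : W' ≤ preimage W') (h : W ≤ W')
    (hr : Module.finrank ℂ W' = Module.finrank ℂ W + 1) : W' ≤ preimage W := by
  have : FiniteDimensional ℂ W := Submodule.finiteDimensional_of_le h
  intro v hv
  -- If tv ∉ W, then W' = W ⊕ ℂ·tv by dimension, so v ≡ c·tv modulo W. Iterating gives v ≡ cᵏtᵏv for
  -- all k, and nilpotence forces v ∈ W, hence tv ∈ W.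
  by_contra hn
  rw [mem_preimage] at hn
  have hle : W ⊔ Submodule.span ℂ {shift v} ≤ W' :=
    sup_le h ((Submodule.span_singleton_le_iff_mem _ _).mpr (hW' hv))
  have hlt : W < W ⊔ Submodule.span ℂ {shift v} := by
    refine lt_of_le_of_ne le_sup_left fun he => hn ?_
    rw [he]
    exact Submodule.mem_sup_right (Submodule.mem_span_singleton_self _)
  have : FiniteDimensional ℂ (W ⊔ Submodule.span ℂ {shift v} : Submodule ℂ Tail) :=
    Submodule.finiteDimensional_of_le hle
  have hlt' := Submodule.finrank_lt_finrank_of_lt hlt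
  have heq := Submodule.eq_of_le_of_finrank_le hle (by omega)
  rw [← heq] at hv
  obtain ⟨w, hw, z, hz, hwz⟩ := Submodule.mem_sup.mp hv
  obtain ⟨c, rfl⟩ := Submodule.mem_span_singleton.mp hz
  have step : ∀ k : ℕ, v - c ^ k • (shift ^ k) v ∈ W := by
    intro k
    induction k with
    | zero => simp
    | succ k ih =>
      have h1 : (shift ^ k) v - c • (shift ^ (k + 1)) v ∈ W := by
        have h2 : v - c • shift v ∈ W := by rwa [← eq_sub_of_add_eq hwz]
        have h3 : (shift ^ k) (v - c • shift v) ∈ W := by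
          clear ih
          induction k with
          | zero => exact h2
          | succ k ih => rw [pow_succ', Module.End.mul_apply]; exact hW ih
        rwa [map_sub, map_smul, ← Module.End.mul_apply, ← pow_succ] at h3
      have := Submodule.add_mem _ ih (Submodule.smul_mem _ (c ^ k) h1)
      rwa [smul_sub, smul_smul, ← pow_succ, sub_add_sub_cancel] at this
  obtain ⟨N, hN⟩ := exists_shift_pow_eq_zero v
  have hvW := step N
  rw [hN, smul_zero, sub_zero] at hvW
  exact hn (hW hvW)

/-- A codimension-one extension is recovered from the direction of its orthogonal complement. -/
theorem next_of_finrank {W W' : Submodule ℂ Tail} [FiniteDimensional ℂ W']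
    (hW : W ≤ preimage W) (hW' : W' ≤ preimage W') (h : W ≤ W')
    (hr : Module.finrank ℂ W' = Module.finrank ℂ W + 1) :
    Module.finrank ℂ ((W' ⊓ Wᗮ).map total) = 1 ∧ next W ((W' ⊓ Wᗮ).map total) = W' := by
  have : FiniteDimensional ℂ W := Submodule.finiteDimensional_of_le h
  have hp := le_preimage_of_finrank hW hW' h hr
  have hg : W' ⊓ Wᗮ ≤ gap W := inf_le_inf_right _ hp
  have : FiniteDimensional ℂ (W' ⊓ Wᗮ : Submodule ℂ Tail) :=
    Submodule.finiteDimensional_of_le hg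
  have h1 := Submodule.finrank_add_inf_finrank_orthogonal h
  rw [inf_comm] at h1
  have h2 := finrank_map_add_finrank_inf_ker total (W' ⊓ Wᗮ)
  have h0 : W' ⊓ Wᗮ ⊓ LinearMap.ker total = ⊥ :=
    (Submodule.eq_bot_iff _).mpr fun a ha => eq_zero_of_mem_gap hW (hg ha.1) ha.2
  rw [h0, finrank_bot, add_zero] at h2
  have h3 : Module.finrank ℂ ((W' ⊓ Wᗮ).map total) = 1 := by omega
  refine ⟨h3, ?_⟩
  symm
  apply Submodule.eq_of_le_of_finrank_eq
  · conv_lhs => rw [← Submodule.sup_orthogonal_inf_of_hasOrthogonalProjection h, inf_comm]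
    exact sup_le_sup_left (le_inf hg (Submodule.le_comap_map _ _)) _
  · rw [finrank_next hW, h3, hr]

end Tail

/-! ### Cancellation of antipodal pairs in words -/

@[simp] theorem submodule_chi (L : CP1) : (chi L).submodule = L.submoduleᗮ :=
  Projectivization.submodule_mk'' _ _

@[simp] theorem chi_chi (L : CP1) : chi (chi L) = L :=
  Projectivization.submodule_injective (by simp)

/-- Deleting an adjacent antipodal pair from a word. -/
inductive CancelStep : List CP1 → List CP1 → Prop
  | intro (a : List CP1) (x : CP1) (b : List CP1) : CancelStep (a ++ x :: chi x :: b) (a ++ b)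

/-- Repeated deletion of adjacent antipodal pairs. -/
def Cancels : List CP1 → List CP1 → Prop := Relation.ReflTransGen CancelStep

theorem CancelStep.length_eq {l l' : List CP1} (h : CancelStep l l') :
    l.length = l'.length + 2 := by
  cases h
  simp
  omega

/-- The reversed pair is again antipodal because χ is an involution. Reversal is needed since
`Tail.span` consumes a word from its end, while the lines of a flag are listed from the start. -/
theorem CancelStep.reverse {l l' : List CP1} (h : CancelStep l l') :
    CancelStep l.reverse l'.reverse := by
  obtain ⟨a, x, b⟩ := h
  simpa using CancelStep.intro b.reverse (chi x) a.reverse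

theorem Cancels.reverse {l l' : List CP1} (h : Cancels l l') : Cancels l.reverse l'.reverse :=
  Relation.ReflTransGen.lift List.reverse (fun _ _ => CancelStep.reverse) _ _ h

theorem CancelStep.cons (y : CP1) {l l' : List CP1} (h : CancelStep l l') :
    CancelStep (y :: l) (y :: l') := by
  obtain ⟨a, x, b⟩ := h
  exact CancelStep.intro (y :: a) x b

theorem Cancels.cons (y : CP1) {l l' : List CP1} (h : Cancels l l') :
    Cancels (y :: l) (y :: l') :=
  Relation.ReflTransGen.lift (y :: ·) (fun _ _ => CancelStep.cons y) _ _ h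

/-! ### The subspace determined by a word -/

namespace Tail

/-- The subspace obtained from zero by successive extension in the directions of a word, the last
letter of the word being used first. -/
def span : List CP1 → Submodule ℂ Tail
  | [] => ⊥
  | x :: l => next (span l) x.submodule

theorem finiteDimensional_span (l : List CP1) : FiniteDimensional ℂ (span l) := by
  induction l with
  | nil => exact inferInstanceAs (FiniteDimensional ℂ (⊥ : Submodule ℂ Tail))
  | cons x l ih => exact inferInstanceAs (FiniteDimensional ℂ (next (span l) x.submodule))

instance (l : List CP1) : FiniteDimensional ℂ (span l) := finiteDimensional_span l

theorem span_le_preimage (l : List CP1) : span l ≤ preimage (span l) := by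
  induction l with
  | nil => exact bot_le
  | cons x l ih => exact next_le_preimage_next ih _

theorem finrank_span (l : List CP1) : Module.finrank ℂ (span l) = l.length := by
  induction l with
  | nil => exact finrank_bot ℂ Tail
  | cons x l ih =>
    rw [span, finrank_next (span_le_preimage l), ih, x.finrank_submodule, List.length_cons]

theorem span_le_span_cons (x : CP1) (l : List CP1) : span l ≤ span (x :: l) := le_next _ _

theorem span_cons_le_preimage (x : CP1) (l : List CP1) : span (x :: l) ≤ preimage (span l) :=
  next_le_preimage (span_le_preimage l) _

/-- By `next_preimage`, a t⁻¹ can be moved outwards past every further letter. -/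
theorem span_append_of_eq_preimage {l l' : List CP1} (h : span l' = preimage (span l))
    (a : List CP1) : span (a ++ l') = preimage (span (a ++ l)) := by
  induction a with
  | nil => exact h
  | cons x a ih =>
    rw [List.cons_append, List.cons_append, span, span, ih, next_preimage (span_le_preimage _)]

theorem span_cons_chi_cons (x : CP1) (l : List CP1) :
    span (chi x :: x :: l) = preimage (span l) := by
  rw [span, span, submodule_chi, next_next_orthogonal (span_le_preimage l)]

theorem span_of_cancelStep {l l' : List CP1} (h : CancelStep l l') :
    span l = preimage (span l') := by
  obtain ⟨a, x, b⟩ := h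
  refine span_append_of_eq_preimage ?_ a
  simpa using span_cons_chi_cons (chi x) b

/-- The kernel of `tⁿ`, as an iterated preimage of zero. -/
def level (n : ℕ) : Submodule ℂ Tail := preimage^[n] ⊥

theorem level_succ (n : ℕ) : level (n + 1) = preimage (level n) :=
  Function.iterate_succ_apply' _ _ _

theorem span_of_cancels {l : List CP1} (h : Cancels l []) {n : ℕ} (hl : l.length = 2 * n) :
    span l = level n := by
  induction h using Relation.ReflTransGen.head_induction_on generalizing n with
  | refl =>
    have : n = 0 := by simpa using hl
    subst this
    rfl
  | head h _ ih =>
    have := h.length_eq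
    obtain ⟨k, rfl⟩ : ∃ k, n = k + 1 := ⟨n - 1, by omega⟩
    rw [span_of_cancelStep h, level_succ, ih (n := k) (by omega)]

/-- In the shortest suffix `y :: x :: b` whose subspace contains ker t, dimension counting gives
span (y :: x :: b) = t⁻¹ span b. This is also the subspace of `chi x :: x :: b`, and directions are
determined by extensions, so y = χ x. -/
theorem exists_cancelStep {l : List CP1} (h : LinearMap.ker shift ≤ span l) :
    ∃ l', CancelStep l l' := by
  induction l with
  | nil =>
    have := Submodule.finrank_mono h
    rw [finrank_ker_shift, finrank_span] at this
    simp at this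
  | cons y l ih =>
    by_cases hl : LinearMap.ker shift ≤ span l
    · obtain ⟨l', h'⟩ := ih hl
      exact ⟨_, h'.cons y⟩
    · rcases l with _ | ⟨x, b⟩
      · have := Submodule.finrank_mono h
        rw [finrank_ker_shift, finrank_span] at this
        simp at this
      -- The subspace of `x :: b` meets ker t in dimension at most 1, so its image under t has
      -- dimension at least that of `span b`, in which it is contained.
      have hlt : span (x :: b) ⊓ LinearMap.ker shift < LinearMap.ker shift :=
        lt_of_le_of_ne inf_le_right fun he => hl (inf_eq_right.mp he)
      have h1 := Submodule.finrank_lt_finrank_of_lt hlt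
      have h2 := finrank_map_add_finrank_inf_ker shift (span (x :: b))
      have h3 : (span (x :: b)).map shift ≤ span b :=
        Submodule.map_le_iff_le_comap.mpr (span_cons_le_preimage x b)
      rw [finrank_ker_shift] at h1
      rw [finrank_span, List.length_cons] at h2
      have h4 : (span (x :: b)).map shift = span b := by
        refine Submodule.eq_of_le_of_finrank_le h3 ?_
        rw [finrank_span]
        omega
      have h5 := finrank_map_add_finrank_inf_ker shift (span (y :: x :: b))
      rw [inf_eq_right.mpr h, finrank_ker_shift, finrank_span] at h5
      have h6 : span b = (span (y :: x :: b)).map shift := by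
        refine Submodule.eq_of_le_of_finrank_le ?_ ?_
        · rw [← h4]
          exact Submodule.map_mono (span_le_span_cons _ _)
        · rw [finrank_span]
          simp only [List.length_cons] at h5
          omega
      have h7 : span (y :: x :: b) = preimage (span b) := by
        refine Submodule.eq_of_le_of_finrank_eq (Submodule.map_le_iff_le_comap.mp h6.ge) ?_
        rw [finrank_preimage, finrank_span, finrank_span]
        rfl
      rw [← span_cons_chi_cons x b] at h7
      have h8 := Projectivization.submodule_injective
        (next_injective (span_le_preimage (x :: b)) h7)
      refine ⟨b, ?_⟩
      rw [h8]
      simpa using CancelStep.intro [] (chi x) b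

/-- The subspace t⁻¹(`level n`) contains ker t, so some pair cancels; injectivity of W ↦ t⁻¹W
identifies the subspace of the shorter word with `level n`. -/
theorem cancels_of_span {l : List CP1} {n : ℕ} (h : span l = level n) : Cancels l [] := by
  induction n generalizing l with
  | zero =>
    have := finrank_span l
    rw [h, level, Function.iterate_zero, id, finrank_bot] at this
    rw [List.length_eq_zero_iff.mp this.symm]
    exact Relation.ReflTransGen.refl
  | succ n ih =>
    rw [level_succ] at h
    obtain ⟨l', h'⟩ := exists_cancelStep (l := l) (h ▸ ker_le_preimage _)
    rw [span_of_cancelStep h'] at h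
    exact Relation.ReflTransGen.head h' (ih (preimage_injective h))

instance (n : ℕ) : FiniteDimensional ℂ (level n) := by
  induction n with
  | zero => exact inferInstanceAs (FiniteDimensional ℂ (⊥ : Submodule ℂ Tail))
  | succ n ih => rw [level_succ]; infer_instance

theorem finrank_level (n : ℕ) : Module.finrank ℂ (level n) = 2 * n := by
  induction n with
  | zero => exact finrank_bot ℂ Tail
  | succ n ih => rw [level_succ, finrank_preimage, ih]; omega

theorem mem_level {n : ℕ} {a : Tail} : a ∈ level n ↔ (shift ^ n) a = 0 := by
  induction n generalizing a with
  | zero => exact Iff.rfl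
  | succ n ih => rw [level_succ, mem_preimage, ih, pow_succ, Module.End.mul_apply]

end Tail

/-! ### From cancelling words to non-crossing matchings -/

/-- A non-crossing matching of the positions of a word, with antipodal letters at matched
positions. -/
structure IsWordMatching (l : List CP1) (τ : ℕ → ℕ) : Prop where
  lt : ∀ i < l.length, τ i < l.length
  invol : ∀ i < l.length, τ (τ i) = i
  ne : ∀ i < l.length, τ i ≠ i
  nonCrossing : ∀ i < l.length, ∀ j < l.length, i < j → j < τ i → ¬ τ i < τ j
  label : ∀ i < l.length, l[τ i]? = l[i]?.map chi

/-- The matching of `a ++ x :: chi x :: b` obtained from one of `a ++ b`, with `p = a.length`. -/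
def insertPair (p : ℕ) (τ : ℕ → ℕ) (i : ℕ) : ℕ :=
  if i = p then p + 1 else if i = p + 1 then p else
    if τ (if i < p then i else i - 2) < p then τ (if i < p then i else i - 2)
    else τ (if i < p then i else i - 2) + 2

/-- The old positions embed in an order-preserving way by skipping p and p + 1. The new arc joins
neighbours, so no other arc can end strictly inside it and nothing crosses it. -/
theorem IsWordMatching.insert {a b : List CP1} {x : CP1} {τ : ℕ → ℕ}
    (h : IsWordMatching (a ++ b) τ) :
    IsWordMatching (a ++ x :: chi x :: b) (insertPair a.length τ) := by
  obtain ⟨h1, h2, h3, h4, h5⟩ := h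
  have hlen : (a ++ x :: chi x :: b).length = a.length + (b.length + 1 + 1) := by simp
  rw [List.length_append] at h1 h2 h3 h4 h5
  set p := a.length
  set q := b.length
  have e : ∀ i, i < p + (q + 1 + 1) → i = p ∨ i = p + 1 ∨
      ∃ j < p + q, i = if j < p then j else j + 2 := by
    intro i hi
    by_cases h : i < p
    · exact Or.inr (Or.inr ⟨i, by omega, by simp [h]⟩)
    · by_cases h' : i = p
      · exact Or.inl h'
      by_cases h'' : i = p + 1
      · exact Or.inr (Or.inl h'')
      · exact Or.inr (Or.inr ⟨i - 2, by omega, by split_ifs <;> omega⟩)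
  have v0 : insertPair p τ p = p + 1 := by simp [insertPair]
  have v1 : insertPair p τ (p + 1) = p := by simp [insertPair]
  have v2 : ∀ j, insertPair p τ (if j < p then j else j + 2) =
      if τ j < p then τ j else τ j + 2 := by
    intro j
    have : (if (if j < p then j else j + 2) < p then (if j < p then j else j + 2)
      else (if j < p then j else j + 2) - 2) = j := by split_ifs <;> omega
    unfold insertPair
    rw [this, if_neg, if_neg] <;> split_ifs <;> omega
  have g : ∀ j, (a ++ x :: chi x :: b)[if j < p then j else j + 2]? = (a ++ b)[j]? := by
    intro j
    split_ifs with hj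
    · rw [List.getElem?_append_left hj, List.getElem?_append_left hj]
    · rw [List.getElem?_append_right (by omega), List.getElem?_append_right (by omega)]
      have : j + 2 - p = (j - p) + 1 + 1 := by omega
      change (x :: chi x :: b)[j + 2 - p]? = _
      rw [this, List.getElem?_cons_succ, List.getElem?_cons_succ]
  have g0 : (a ++ x :: chi x :: b)[p]? = some x := by simp [p]
  have g1 : (a ++ x :: chi x :: b)[p + 1]? = some (chi x) := by
    rw [List.getElem?_append_right (by omega)]; simp [p]
  constructor <;> rw [hlen]
  · intro i hi
    rcases e i hi with rfl | rfl | ⟨j, hj, rfl⟩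
    · omega
    · omega
    · rw [v2]
      have := h1 j hj
      split_ifs <;> omega
  · intro i hi
    rcases e i hi with rfl | rfl | ⟨j, hj, rfl⟩
    · rw [v0, v1]
    · rw [v1, v0]
    · rw [v2, v2, h2 j hj]
  · intro i hi
    rcases e i hi with rfl | rfl | ⟨j, hj, rfl⟩
    · omega
    · omega
    · rw [v2]
      have := h3 j hj
      split_ifs <;> omega
  · intro i hi k hk
    rcases e i hi with rfl | rfl | ⟨j, hj, rfl⟩
    · omega
    · omega
    · rcases e k hk with rfl | rfl | ⟨m, hm, rfl⟩
      · rw [v2, v0]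
        split_ifs <;> omega
      · rw [v2, v1]
        split_ifs <;> omega
      · rw [v2, v2]
        have := h4 j hj m hm
        split_ifs <;> omega
  · intro i hi
    rcases e i hi with rfl | rfl | ⟨j, hj, rfl⟩
    · rw [v0, g0, g1]; rfl
    · rw [v1, g0, g1]; simp
    · rw [v2, g, g, h5 j hj]

theorem exists_isWordMatching {l : List CP1} (h : Cancels l []) : ∃ τ, IsWordMatching l τ := by
  induction h using Relation.ReflTransGen.head_induction_on with
  | refl => exact ⟨id, by constructor <;> simp⟩
  | head h _ ih =>
    obtain ⟨a, x, b⟩ := h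
    obtain ⟨τ, hτ⟩ := ih
    exact ⟨_, hτ.insert⟩

theorem exists_isNonCrossingMatching {m : ℕ} {u : Fin m → CP1} (h : Cancels (List.ofFn u) []) :
    ∃ τ : Equiv.Perm (Fin m), IsNonCrossingMatching τ ∧ ∀ i, u (τ i) = chi (u i) := by
  obtain ⟨τ, h1, h2, h3, h4, h5⟩ := exists_isWordMatching h
  simp only [List.length_ofFn] at *
  let f : Fin m → Fin m := fun i => ⟨τ i, h1 i i.2⟩
  have hf : Function.Involutive f := fun i => Fin.ext (h2 i i.2)
  refine ⟨hf.toPerm, ⟨hf, fun i hi => h3 i i.2 (congrArg Fin.val hi), ?_⟩, fun i => ?_⟩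
  · rintro ⟨i, j, hij, hji, hτ⟩
    exact h4 i i.2 j j.2 hij hji hτ
  · have := h5 i i.2
    rw [List.getElem?_ofFn, List.getElem?_ofFn, dif_pos (h1 i i.2), dif_pos i.2] at this
    exact Option.some.inj this

/-! ### Sparseness of the set of opening positions -/

/-- The opening positions of a matching. -/
def openers {m : ℕ} (τ : Equiv.Perm (Fin m)) : Finset (Fin m) := Finset.univ.filter fun i => i < τ i

theorem mem_openers {m : ℕ} {τ : Equiv.Perm (Fin m)} {i : Fin m} : i ∈ openers τ ↔ i < τ i := by
  simp [openers]

theorem IsNonCrossingMatching.notMem_openers {m : ℕ} {τ : Equiv.Perm (Fin m)}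
    (h : IsNonCrossingMatching τ) {i : Fin m} (hi : i ∈ openers τ) : τ i ∉ openers τ := by
  rw [mem_openers] at *
  rw [h.1]
  exact hi.le.not_gt

/-- The matching exchanges openers and closers, so each is half of the 2n positions. -/
theorem IsNonCrossingMatching.card_openers {n : ℕ} {τ : Equiv.Perm (Fin (2 * n))}
    (h : IsNonCrossingMatching τ) : (openers τ).card = n := by
  have h1 : (openers τ)ᶜ = (openers τ).image τ := by
    ext i
    rw [Finset.mem_compl, Finset.mem_image]
    constructor
    · intro hi
      refine ⟨τ i, ?_, h.1 i⟩
      rw [mem_openers] at *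
      rw [h.1]
      exact lt_of_le_of_ne (not_lt.mp hi) (h.2.1 i)
    · rintro ⟨j, hj, rfl⟩
      exact h.notMem_openers hj
  have h2 := Finset.card_add_card_compl (openers τ)
  rw [h1, Finset.card_image_of_injective _ τ.injective, Fintype.card_fin] at h2
  omega

/-- The matching injects the openers beyond j into the closers beyond j and misses the closer `τ j`.
-/
theorem IsNonCrossingMatching.isSparse_openers {m : ℕ} {τ : Equiv.Perm (Fin m)}
    (h : IsNonCrossingMatching τ) : IsSparse (openers τ) := by
  intro j hj
  rw [← Finset.card_image_of_injective _ τ.injective]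
  refine Finset.card_lt_card ((Finset.ssubset_iff_of_subset ?_).mpr ⟨τ j, ?_, ?_⟩)
  · intro k hk
    obtain ⟨i, hi, rfl⟩ := Finset.mem_image.mp hk
    rw [Finset.mem_filter] at hi ⊢
    exact ⟨Finset.mem_compl.mpr (h.notMem_openers hi.1), hi.2.trans (mem_openers.mp hi.1)⟩
  · rw [Finset.mem_filter]
    exact ⟨Finset.mem_compl.mpr (h.notMem_openers hj), mem_openers.mp hj⟩
  · intro hk
    obtain ⟨i, hi, hij⟩ := Finset.mem_image.mp hk
    rw [τ.injective hij] at hi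
    exact lt_irrefl _ (Finset.mem_filter.mp hi).2

/-- The index K carries no extra information: it is the set of openers of τ, which is automatically
sparse of size n. -/
theorem mem_XPrime_iff {n : ℕ} {u : Fin (2 * n) → CP1} : u ∈ XPrime n ↔
    ∃ τ : Equiv.Perm (Fin (2 * n)), IsNonCrossingMatching τ ∧ ∀ i, u (τ i) = chi (u i) := by
  simp only [XPrime, Set.mem_iUnion]
  constructor
  · rintro ⟨K, -, τ, h, -, hu⟩
    exact ⟨τ, h, hu⟩
  · rintro ⟨τ, h, hu⟩
    exact ⟨openers τ, ⟨h.isSparse_openers, h.card_openers⟩, τ, h, fun i => mem_openers, hu⟩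

/-! ### Closed walks in trees have cancelling words -/

/-- The word of a walk reduces to that of the path with the same ends, by induction on the walk; a
closed walk thus reduces to the empty word. -/
theorem walk_cancels {A : Type*} {T : SimpleGraph A} (hT : T.IsAcyclic) {m : T.Dart → CP1}
    (hm : m ∈ Y1 T) {a b : A} (w : T.Walk a b) (p : T.Walk a b) (hp : p.IsPath) :
    Cancels (w.darts.map m) (p.darts.map m) := by
  induction w with
  | nil =>
    rw [(SimpleGraph.Walk.isPath_iff_nil.mp hp).eq_nil]
    exact Relation.ReflTransGen.refl
  | @cons a a' b h w ih =>
    -- If p visits a', acyclicity makes a → a' its first edge, and that letter is common to both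
    -- words. Otherwise a' → a followed by p is a path, and the forward and backward edges give an
    -- antipodal pair to cancel.
    by_cases ha : a' ∈ p.support
    · have hs := hT.eq_snd_of_adj_start hp h ha
      cases p with
      | nil =>
        rw [SimpleGraph.Walk.support_nil, List.mem_singleton] at ha
        exact (h.ne ha.symm).elim
      | cons h' p =>
        rw [SimpleGraph.Walk.snd_cons] at hs
        subst hs
        exact (ih p hp.of_cons).cons _
    · have := (ih (SimpleGraph.Walk.cons h.symm p) (hp.cons ha)).cons (m ⟨(a, a'), h⟩)
      refine this.tail ?_
      have e : m ⟨(a', a), h.symm⟩ = chi (m ⟨(a, a'), h⟩) := hm ⟨(a, a'), h⟩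
      rw [SimpleGraph.Walk.darts_cons, List.map_cons, e]
      exact CancelStep.intro [] _ _

theorem cancels_of_mem_Y {n : ℕ} {m : (polygon n).graph.Dart → CP1} (hm : m ∈ Y (polygon n)) :
    Cancels (List.ofFn fun i => m (polygonEdge n i)) [] := by
  obtain ⟨s, hs, hT, m', hm', rfl⟩ := hm
  set p := (polygon n).folding s hs
  set l := List.ofFn fun i => m' (p.mapDart (polygonEdge n i)) with hl
  -- The end vertex is a variable with an equation so that, at k = 2n, it can be taken to be `p 0`
  -- and the walk is literally closed.
  have key : ∀ k ≤ 2 * n, ∀ v, v = p (k : ZMod (2 * n)) →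
      ∃ w : ((polygon n).quotient s).Walk (p 0) v, w.darts.map m' = l.take k := by
    intro k
    induction k with
    | zero =>
      rintro - v rfl
      rw [Nat.cast_zero]
      exact ⟨SimpleGraph.Walk.nil, by simp⟩
    | succ k ih =>
      intro hk v hv
      obtain ⟨w, hw⟩ := ih (by omega) _ rfl
      rw [Nat.cast_succ] at hv
      subst hv
      have hadj : ((polygon n).quotient s).Adj (p k) (p (k + 1)) :=
        (p.mapDart (polygonEdge n ⟨k, by omega⟩)).adj
      refine ⟨w.concat hadj, ?_⟩
      rw [SimpleGraph.Walk.darts_concat, List.concat_eq_append, List.map_append, hw,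
        ← List.take_concat_get' l k (by simp [hl]; omega)]
      congr 1
      simp only [List.map_cons, List.map_nil, hl, List.getElem_ofFn]
      rfl
  obtain ⟨w, hw⟩ := key (2 * n) le_rfl (p 0) (by rw [ZMod.natCast_self])
  rw [List.take_of_length_le (by simp [hl])] at hw
  rw [← hw]
  exact walk_cancels hT.isAcyclic hm' w SimpleGraph.Walk.nil SimpleGraph.Walk.IsPath.nil

/-! ### The tree folding of a non-crossing matching -/

section Covering

variable {n : ℕ} {τ : Equiv.Perm (Fin (2 * n))}

/-- The arcs of the matching covering the vertex `a`, labelled by their left ends. -/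
def covering (τ : Equiv.Perm (Fin (2 * n))) (a : ℕ) : Finset (Fin (2 * n)) :=
  Finset.univ.filter fun k => (k : ℕ) < a ∧ a ≤ τ k

theorem mem_covering {a : ℕ} {k : Fin (2 * n)} : k ∈ covering τ a ↔ (k : ℕ) < a ∧ a ≤ τ k := by
  simp [covering]

theorem covering_zero : covering τ 0 = ∅ := by
  ext k
  simp [mem_covering]

theorem covering_last : covering τ (2 * n) = ∅ := by
  ext k
  simp [mem_covering]

/-- Along the polygon, arc j is entered only at edge j and left only at edge `τ j`; the next lemma
treats leaving. -/
theorem eq_of_mem_covering_succ {j i : Fin (2 * n)} (h : j ∈ covering τ (i + 1))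
    (h' : j ∉ covering τ i) : i = j := by
  rw [mem_covering] at h h'
  apply Fin.ext
  omega

theorem eq_of_notMem_covering_succ {j i : Fin (2 * n)} (h : j ∉ covering τ (i + 1))
    (h' : j ∈ covering τ i) : i = τ j := by
  rw [mem_covering] at h h'
  apply Fin.ext
  omega

theorem covering_succ_of_lt (h : IsNonCrossingMatching τ) {k : Fin (2 * n)} (hk : k < τ k) :
    k ∉ covering τ k ∧ covering τ (k + 1) = insert k (covering τ k) := by
  have hk' : (k : ℕ) < τ k := hk
  refine ⟨by simp [mem_covering], ?_⟩
  ext j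
  rw [Finset.mem_insert, mem_covering, mem_covering]
  constructor
  · rintro ⟨h1, h2⟩
    by_cases hj : j = k
    · exact Or.inl hj
    · have : (j : ℕ) ≠ k := fun e => hj (Fin.ext e)
      exact Or.inr ⟨by omega, by omega⟩
  · rintro (rfl | ⟨h1, h2⟩)
    · omega
    · have : (τ j : ℕ) ≠ k := by
        intro e
        have e : τ j = k := Fin.ext e
        rw [← e, h.1] at hk'
        rw [e] at hk'
        omega
      omega

theorem covering_of_gt (h : IsNonCrossingMatching τ) {k : Fin (2 * n)} (hk : τ k < k) :
    τ k ∉ covering τ (k + 1) ∧ covering τ k = insert (τ k) (covering τ (k + 1)) := by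
  have hk' : (τ k : ℕ) < k := hk
  refine ⟨by simp [mem_covering, h.1], ?_⟩
  ext j
  rw [Finset.mem_insert, mem_covering, mem_covering]
  constructor
  · rintro ⟨h1, h2⟩
    by_cases hj : τ j = k
    · exact Or.inl (by rw [← hj, h.1])
    · have : (τ j : ℕ) ≠ k := fun e => hj (Fin.ext e)
      exact Or.inr ⟨by omega, by omega⟩
  · rintro (rfl | ⟨h1, h2⟩)
    · rw [h.1]
      omega
    · have : (j : ℕ) ≠ k := by
        intro e
        rw [Fin.ext e] at h2
        omega
      omega

/-- Here non-crossing enters: an arc covering just one of the two outer end points of arc k would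
cross it. -/
theorem covering_match (h : IsNonCrossingMatching τ) {k : Fin (2 * n)} (hk : k < τ k) :
    covering τ (τ k + 1) = covering τ k := by
  have hk' : (k : ℕ) < τ k := hk
  ext j
  rw [mem_covering, mem_covering]
  have hinj : ∀ i, (τ j : ℕ) = τ i → j = i := fun i e => τ.injective (Fin.ext e)
  constructor
  · rintro ⟨h1, h2⟩
    have h3 : (j : ℕ) ≠ τ k := by
      intro e
      rw [Fin.ext e, h.1] at h2
      omega
    have h4 : (j : ℕ) ≠ k := by
      intro e
      rw [Fin.ext e] at h2
      omega
    have h5 : ¬ (k < j) := fun hkj => h.2.2 ⟨k, j, hkj, Fin.lt_def.mpr (by omega),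
      Fin.lt_def.mpr (by omega)⟩
    have h6 : (j : ℕ) ≤ k := not_lt.mp h5
    omega
  · rintro ⟨h1, h2⟩
    have h3 : (τ j : ℕ) ≠ k := by
      intro e
      have e' : j = τ k := by rw [← (Fin.ext e : τ j = k), h.1]
      rw [e'] at h1
      omega
    have h4 : (τ j : ℕ) ≠ τ k := fun e => by
      rw [hinj k e] at h1
      omega
    have h5 : ¬ (τ j < τ k) := fun hlt => h.2.2 ⟨j, k, Fin.lt_def.mpr h1,
      Fin.lt_def.mpr (by omega), hlt⟩
    have h6 : (τ k : ℕ) ≤ τ j := not_lt.mp h5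
    omega

/-- The edges `k` and `τ k` have the same end points in the quotient, in opposite order. -/
theorem covering_symm (h : IsNonCrossingMatching τ) (k : Fin (2 * n)) :
    covering τ (τ k + 1) = covering τ k ∧ covering τ (τ k) = covering τ (k + 1) := by
  have aux : ∀ k : Fin (2 * n), k < τ k →
      covering τ (τ k + 1) = covering τ k ∧ covering τ (τ k) = covering τ (k + 1) := by
    intro k hk
    have h1 := covering_match h hk
    refine ⟨h1, ?_⟩
    have hgt := (covering_of_gt (k := τ k) h (by rwa [h.1])).2
    rw [h.1, h1] at hgt
    rw [hgt, (covering_succ_of_lt h hk).2]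
  rcases lt_or_gt_of_ne (h.2.1 k) with hk | hk
  · have := aux (τ k) (by rwa [h.1])
    rw [h.1] at this
    exact ⟨this.2.symm, this.1.symm⟩
  · exact aux k hk

/-- The arc whose membership changes, together with the direction of change, determines the edge.
This makes labels on oriented tree edges well defined. -/
theorem covering_edge_injective (h : IsNonCrossingMatching τ) {j k : Fin (2 * n)}
    (h1 : covering τ j = covering τ k) (h2 : covering τ (j + 1) = covering τ (k + 1)) :
    j = k := by
  rcases lt_or_gt_of_ne (h.2.1 k) with hk | hk
  · obtain ⟨h3, h4⟩ := covering_of_gt h hk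
    have := eq_of_notMem_covering_succ (j := τ k) (i := j) (h2 ▸ h3)
      (by rw [h1, h4]; exact Finset.mem_insert_self _ _)
    rwa [h.1] at this
  · obtain ⟨h3, h4⟩ := covering_succ_of_lt h hk
    exact eq_of_mem_covering_succ (by rw [h2, h4]; exact Finset.mem_insert_self _ _) (h1 ▸ h3)

/-- Each edge adds or removes exactly one arc. Hence vertices with equal coverings have equal
parity. -/
theorem card_covering (h : IsNonCrossingMatching τ) {a : ℕ} (ha : a ≤ 2 * n) :
    ((covering τ a).card : ZMod 2) = a := by
  induction a with
  | zero => simp [covering_zero]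
  | succ a ih =>
    have ih := ih (by omega)
    let k : Fin (2 * n) := ⟨a, by omega⟩
    rcases lt_or_gt_of_ne (h.2.1 k) with hk | hk
    · obtain ⟨h3, h4⟩ := covering_of_gt h hk
      change ((covering τ (k + 1)).card : ZMod 2) = _
      change ((covering τ k).card : ZMod 2) = _ at ih
      rw [h4, Finset.card_insert_of_notMem h3] at ih
      push_cast at ih ⊢
      rw [← ih, add_assoc, CharTwo.add_self_eq_zero, add_zero]
    · obtain ⟨h3, h4⟩ := covering_succ_of_lt h hk
      change ((covering τ (k + 1)).card : ZMod 2) = _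
      change ((covering τ k).card : ZMod 2) = _ at ih
      rw [h4, Finset.card_insert_of_notMem h3]
      push_cast
      rw [ih]

/-- The arcs covering a vertex of the polygon. -/
def vertexCovering (τ : Equiv.Perm (Fin (2 * n))) (v : ZMod (2 * n)) : Finset (Fin (2 * n)) :=
  covering τ v.val

/-- The bound includes a = 2n, which is the vertex 0 again; neither end is covered by an arc. -/
theorem vertexCovering_natCast {a : ℕ} (ha : a ≤ 2 * n) :
    vertexCovering τ (a : ZMod (2 * n)) = covering τ a := by
  rcases ha.lt_or_eq with h | rfl
  · rw [vertexCovering, ZMod.val_natCast_of_lt h]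
  · rw [vertexCovering, ZMod.natCast_self, ZMod.val_zero, covering_zero, covering_last]

theorem exists_polygonEdge (hn : 0 < n) (d : (polygon n).graph.Dart) :
    ∃ i, d = polygonEdge n i ∨ d = (polygonEdge n i).symm := by
  have : NeZero (2 * n) := ⟨by omega⟩
  obtain ⟨⟨a, b⟩, h⟩ := d
  rcases h with h | h
  · refine ⟨⟨a.val, a.val_lt⟩, Or.inl (SimpleGraph.Dart.ext _ _ ?_)⟩
    simp only at h
    simp [polygonEdge, h]
  · refine ⟨⟨b.val, b.val_lt⟩, Or.inr (SimpleGraph.Dart.ext _ _ ?_)⟩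
    simp only at h
    simp [polygonEdge, h]

/-- The equivalence relation of lying under the same arcs. -/
def coveringSetoid (τ : Equiv.Perm (Fin (2 * n))) : Setoid (ZMod (2 * n)) :=
  Setoid.ker (vertexCovering τ)

theorem foldable_coveringSetoid (hn : 0 < n) (h : IsNonCrossingMatching τ) :
    (polygon n).Foldable (coveringSetoid τ) := by
  have : NeZero (2 * n) := ⟨by omega⟩
  have key : ∀ u : ZMod (2 * n), polygonParity n u = ((vertexCovering τ u).card : ZMod 2) := by
    intro u
    rw [vertexCovering, card_covering h u.val_lt.le]
    conv_lhs => rw [← ZMod.natCast_zmod_val u]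
    exact map_natCast _ _
  intro u v huv
  change polygonParity n u = polygonParity n v
  rw [key, key, show vertexCovering τ u = vertexCovering τ v from huv]

/-- The arcs covering a vertex of the quotient. -/
def classCovering (τ : Equiv.Perm (Fin (2 * n))) :
    Quotient (coveringSetoid τ) → Finset (Fin (2 * n)) :=
  Setoid.kerLift (vertexCovering τ)

theorem classCovering_injective : Function.Injective (classCovering τ) :=
  Setoid.kerLift_injective _

/-- A negatively oriented edge k has the same image as the positively oriented edge `τ k`, so
positive edges suffice. -/
theorem exists_edge_of_adj (hn : 0 < n) (h : IsNonCrossingMatching τ)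
    {a b : Quotient (coveringSetoid τ)} (hab : ((polygon n).quotient (coveringSetoid τ)).Adj a b) :
    ∃ k : Fin (2 * n),
      classCovering τ a = covering τ k ∧ classCovering τ b = covering τ (k + 1) := by
  obtain ⟨-, u, v, huv, rfl, rfl⟩ := hab
  have hv : ∀ k : Fin (2 * n), vertexCovering τ (k : ℕ) = covering τ k ∧
      vertexCovering τ ((k : ℕ) + 1) = covering τ (k + 1) := fun k => by
    rw [← Nat.cast_succ]
    exact ⟨vertexCovering_natCast (by omega), vertexCovering_natCast (by omega)⟩
  obtain ⟨k, hk | hk⟩ := exists_polygonEdge hn ⟨(u, v), huv⟩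
  · cases hk
    exact ⟨k, hv k⟩
  · cases hk
    refine ⟨τ k, ?_⟩
    rw [(covering_symm h k).1, (covering_symm h k).2]
    exact (hv k).symm

/-- Every edge is a bridge: exactly one arc changes across it, and no other edge of the quotient
changes membership of that arc, so membership separates its ends after deletion. -/
theorem isTree_coveringSetoid (hn : 0 < n) (h : IsNonCrossingMatching τ) :
    ((polygon n).quotient (coveringSetoid τ)).IsTree := by
  refine ⟨(polygon n).connected.map ((polygon n).folding _ (foldable_coveringSetoid hn h))
    Quotient.mk_surjective, ?_⟩
  rw [SimpleGraph.isAcyclic_iff_forall_adj_isBridge]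
  intro v w hvw
  rw [SimpleGraph.isBridge_iff]
  obtain ⟨k, hk1, hk2⟩ := exists_edge_of_adj hn h hvw
  -- j is the left end of the arc {k, τ k}.
  obtain ⟨j, hj, hjvw⟩ : ∃ j, (j = k ∨ j = τ k) ∧
      ¬ (j ∈ classCovering τ v ↔ j ∈ classCovering τ w) := by
    rw [hk1, hk2]
    rcases lt_or_gt_of_ne (h.2.1 k) with hk | hk
    · obtain ⟨h3, h4⟩ := covering_of_gt h hk
      refine ⟨τ k, Or.inr rfl, fun hiff => h3 (hiff.mp ?_)⟩
      rw [h4]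
      exact Finset.mem_insert_self _ _
    · obtain ⟨h3, h4⟩ := covering_succ_of_lt h hk
      refine ⟨k, Or.inl rfl, fun hiff => h3 (hiff.mpr ?_)⟩
      rw [h4]
      exact Finset.mem_insert_self _ _
  rintro ⟨p⟩
  refine hjvw ?_
  clear hjvw
  have step : ∀ a b, (((polygon n).quotient (coveringSetoid τ)).deleteEdges {s(v, w)}).Adj a b →
      (j ∈ classCovering τ a ↔ j ∈ classCovering τ b) := by
    intro a b hab
    rw [SimpleGraph.deleteEdges_adj] at hab
    obtain ⟨i, hi1, hi2⟩ := exists_edge_of_adj hn h hab.1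
    have hik : i ≠ k := by
      rintro rfl
      rw [← hk1] at hi1
      rw [← hk2] at hi2
      rw [classCovering_injective hi1, classCovering_injective hi2] at hab
      exact hab.2 rfl
    have hiτ : i ≠ τ k := by
      rintro rfl
      rw [(covering_symm h k).2, ← hk2] at hi1
      rw [(covering_symm h k).1, ← hk1] at hi2
      rw [classCovering_injective hi1, classCovering_injective hi2] at hab
      exact hab.2 Sym2.eq_swap
    rw [hi1, hi2]
    by_contra hne
    by_cases hji : j ∈ covering τ i
    · have := eq_of_notMem_covering_succ (fun h' => hne (iff_of_true hji h')) hji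
      rcases hj with rfl | rfl
      · exact hiτ this
      · rw [h.1] at this
        exact hik this
    · have := eq_of_mem_covering_succ (by_contra fun h' => hne (iff_of_false hji h')) hji
      rcases hj with rfl | rfl
      · exact hik this
      · exact hiτ this
  clear hk1 hk2 hvw
  generalize ((polygon n).quotient (coveringSetoid τ)).deleteEdges {s(v, w)} = G at p step
  induction p with
  | nil => exact Iff.rfl
  | cons hab _ ih => exact (step _ _ hab).trans ih

theorem exists_mem_Y (hn : 0 < n) {u : Fin (2 * n) → CP1} (hu : u ∈ XPrime n) :
    ∃ m ∈ Y (polygon n), ∀ i, m (polygonEdge n i) = u i := by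
  obtain ⟨τ, h, hu⟩ := mem_XPrime_iff.mp hu
  choose k hk1 hk2 using fun d : ((polygon n).quotient (coveringSetoid τ)).Dart =>
    exists_edge_of_adj hn h d.adj
  refine ⟨_, ⟨coveringSetoid τ, foldable_coveringSetoid hn h, isTree_coveringSetoid hn h,
    fun d => u (k d), fun d => ?_, rfl⟩, fun i => congrArg u ?_⟩
  · have : k d.symm = τ (k d) := by
      apply covering_edge_injective h
      · rw [(covering_symm h _).2, ← hk1, ← hk2]
        rfl
      · rw [(covering_symm h _).1, ← hk1, ← hk2]
        rfl
    change u (k d.symm) = chi (u (k d))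
    rw [this, hu]
  · apply covering_edge_injective h
    · rw [← hk1]
      exact vertexCovering_natCast (by omega)
    · rw [← hk2]
      change vertexCovering τ ((i : ℕ) + 1) = _
      rw [← Nat.cast_succ]
      exact vertexCovering_natCast (by omega)

end Covering

/-! ### Words, matchings and labelled polygons -/

/-- From a matching to a cancelling word the argument passes through the tree folding. The case n =
0 is separate because `ZMod 0` is ℤ and the polygon is then an infinite line. -/
theorem mem_XPrime_iff_cancels {n : ℕ} {u : Fin (2 * n) → CP1} :
    u ∈ XPrime n ↔ Cancels (List.ofFn u) [] := by
  constructor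
  · intro hu
    rcases Nat.eq_zero_or_pos n with rfl | hn
    · have : List.ofFn u = [] := by
        rw [← List.length_eq_zero_iff, List.length_ofFn]
      rw [this]
      exact Relation.ReflTransGen.refl
    · obtain ⟨m, hm, hmu⟩ := exists_mem_Y hn hu
      have := cancels_of_mem_Y hm
      simpa only [hmu] using this
  · intro h
    exact mem_XPrime_iff.mpr (exists_isNonCrossingMatching h)

theorem Y_subset_Y1 {A : Type*} (G : ParityGraph A) : Y G ⊆ Y1 G.graph := by
  rintro _ ⟨s, hs, -, m', hm', rfl⟩ e
  exact hm' ((G.folding s hs).mapDart e)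

theorem mem_XPrime_of_mem_Y {n : ℕ} {m : (polygon n).graph.Dart → CP1} (hm : m ∈ Y (polygon n)) :
    (fun i => m (polygonEdge n i)) ∈ XPrime n :=
  mem_XPrime_iff_cancels.mpr (cancels_of_mem_Y hm)

/-! ### The embedding of `V(n)` into the tail module -/

theorem coeff_modByMonic_X_pow {n k : ℕ} (hk : k < n) (f : ℂ[X]) :
    (f %ₘ X ^ n).coeff k = f.coeff k := by
  conv_rhs => rw [← modByMonic_add_div f (X ^ n)]
  rw [coeff_add, coeff_X_pow_mul', if_neg (by omega), add_zero]

theorem coeffVec_X_smul {n : ℕ} (i : Fin n) (a : V n) (j : Fin 2) :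
    coeffVec i ((X : ℂ[X]) • a) j = (X * reduced n (a j)).coeff i := by
  change (reduced n ((X : ℂ[X]) • a j)).coeff i = _
  have h : (X : ℂ[X]) • a j = Ideal.Quotient.mk _ (X * reduced n (a j)) := by
    conv_lhs => rw [← mk_reduced n (a j)]
    rfl
  rw [h, reduced_mk, coeff_modByMonic_X_pow i.2]

theorem coeffVec_X_smul_zero {n : ℕ} (h : 0 < n) (a : V n) :
    coeffVec ⟨0, h⟩ ((X : ℂ[X]) • a) = 0 := by
  ext j
  rw [coeffVec_X_smul]
  exact coeff_X_mul_zero _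

theorem coeffVec_X_smul_succ {n k : ℕ} (h : k + 1 < n) (a : V n) :
    coeffVec ⟨k + 1, h⟩ ((X : ℂ[X]) • a) = coeffVec ⟨k, by omega⟩ a := by
  ext j
  rw [coeffVec_X_smul]
  exact coeff_X_mul _ _

theorem X_pow_smul_eq_zero {n : ℕ} (a : V n) : ((X : ℂ[X]) ^ n) • a = 0 := by
  funext j
  obtain ⟨f, hf⟩ := Ideal.Quotient.mk_surjective (a j)
  change ((X : ℂ[X]) ^ n) • a j = 0
  rw [← hf]
  change Ideal.Quotient.mk _ (X ^ n * f) = 0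
  rw [Ideal.Quotient.eq_zero_iff_mem]
  exact Ideal.mul_mem_right _ _ (Ideal.subset_span rfl)

theorem finrank_V (n : ℕ) : Module.finrank ℂ (V n) = 2 * n := by
  have : Module.Finite ℂ (ℂ[X] ⧸ Ideal.span {(X : ℂ[X]) ^ n}) :=
    (AdjoinRoot.powerBasis' (monic_X_pow (R := ℂ) n)).finite
  have h : Module.finrank ℂ (ℂ[X] ⧸ Ideal.span {(X : ℂ[X]) ^ n}) = n := by
    have : Module.finrank ℂ (AdjoinRoot ((X : ℂ[X]) ^ n)) = n := by
      simpa using (AdjoinRoot.powerBasis' (monic_X_pow (R := ℂ) n)).finrank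
    exact this
  have h2 : Module.finrank ℂ (Fin 2 → (ℂ[X] ⧸ Ideal.span {(X : ℂ[X]) ^ n})) = 2 * n := by
    rw [Module.finrank_pi_fintype]
    simp [h]
  exact h2

/-- The coefficients of an element of `V(n)` in reverse order. -/
def revCoeff {n : ℕ} (a : V n) (i : ℕ) : C2 :=
  if h : i < n then coeffVec (Fin.rev ⟨i, h⟩) a else 0

/-- The embedding of `V(n)` into the tail module as the kernel of `tⁿ`. -/
def embed (n : ℕ) : V n →ₗ[ℂ] Tail where
  toFun a := (Finsupp.onFinset (Finset.range n) (revCoeff a) fun i hi => by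
    by_contra h
    exact hi (dif_neg (by simpa using h)) : ℕ →₀ C2)
  map_add' a b := by
    refine Finsupp.ext fun i => ?_
    change revCoeff (a + b) i = revCoeff a i + revCoeff b i
    unfold revCoeff
    split_ifs
    · exact coeffVec_add _ _ _
    · rw [add_zero]
  map_smul' c a := by
    refine Finsupp.ext fun i => ?_
    change revCoeff (c • a) i = c • revCoeff a i
    unfold revCoeff
    split_ifs
    · exact coeffVec_smul _ _ _
    · rw [smul_zero]

theorem coord_embed {n : ℕ} (i : ℕ) (a : V n) : Tail.coord i (embed n a) = revCoeff a i := rfl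

theorem coord_embed_of_le {n : ℕ} (a : V n) (i : ℕ) (hi : n ≤ i) :
    Tail.coord i (embed n a) = 0 :=
  dif_neg (by omega)

theorem coord_embed_fin {n : ℕ} (a : V n) (i : Fin n) :
    Tail.coord i (embed n a) = coeffVec i.rev a :=
  dif_pos i.2

theorem inner_embed {n : ℕ} (a b : V n) : inner ℂ (embed n a) (embed n b) = inner ℂ a b := by
  rw [Tail.inner_eq_sum _ _ (coord_embed_of_le a), Finset.sum_range]
  simp only [coord_embed_fin]
  exact Equiv.sum_comp Fin.revPerm fun i => inner ℂ (coeffVec i a) (coeffVec i b)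

theorem total_embed {n : ℕ} (a : V n) : Tail.total (embed n a) = omega n a := by
  rw [Tail.total_eq_sum _ (coord_embed_of_le a), Finset.sum_range]
  simp only [coord_embed_fin]
  exact Equiv.sum_comp Fin.revPerm fun i => coeffVec i a

/-- Reversing the coefficients turns raising the degree into the backward shift: the top
coefficient, which t kills, sits at index 0. -/
theorem embed_X_smul {n : ℕ} (a : V n) : embed n ((X : ℂ[X]) • a) = Tail.shift (embed n a) := by
  refine Tail.ext_coord fun i => ?_
  rw [Tail.coord_shift, coord_embed, coord_embed]
  unfold revCoeff
  by_cases h : i < n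
  · by_cases h' : i + 1 < n
    · rw [dif_pos h, dif_pos h']
      have e : Fin.rev ⟨i, h⟩ = ⟨n - (i + 2) + 1, by omega⟩ := by
        ext
        simp only [Fin.val_rev]
        omega
      rw [e, coeffVec_X_smul_succ]
      rfl
    · rw [dif_pos h, dif_neg h']
      have e : Fin.rev ⟨i, h⟩ = ⟨0, by omega⟩ := by
        ext
        simp only [Fin.val_rev]
        omega
      rw [e, coeffVec_X_smul_zero]
  · rw [dif_neg h, dif_neg (by omega)]

theorem embed_injective (n : ℕ) : Function.Injective (embed n) := by
  rw [injective_iff_map_eq_zero]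
  intro a ha
  rw [← inner_self_eq_zero (𝕜 := ℂ), ← inner_embed, ha, inner_zero_left]

theorem embed_X_pow_smul {n : ℕ} (k : ℕ) (a : V n) :
    embed n (((X : ℂ[X]) ^ k) • a) = (Tail.shift ^ k) (embed n a) := by
  induction k with
  | zero => simp
  | succ k ih => rw [pow_succ', mul_smul, embed_X_smul, ih, pow_succ', Module.End.mul_apply]

theorem range_embed (n : ℕ) : LinearMap.range (embed n) = Tail.level n := by
  apply Submodule.eq_of_le_of_finrank_eq
  · rintro _ ⟨a, rfl⟩
    rw [Tail.mem_level, ← embed_X_pow_smul, X_pow_smul_eq_zero, map_zero]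
  · rw [LinearMap.finrank_range_of_inj (embed_injective n), finrank_V, Tail.finrank_level]

theorem map_embed_inf_orthogonal {n : ℕ} (A B : Submodule ℂ (V n)) :
    (A ⊓ Bᗮ).map (embed n) = A.map (embed n) ⊓ (B.map (embed n))ᗮ := by
  ext x
  constructor
  · rintro ⟨a, ⟨ha, hb⟩, rfl⟩
    refine ⟨⟨a, ha, rfl⟩, ?_⟩
    rintro _ ⟨b, hbB, rfl⟩
    rw [inner_embed]
    exact hb b hbB
  · rintro ⟨⟨a, ha, rfl⟩, hb⟩
    refine ⟨a, ⟨ha, fun b hbB => ?_⟩, rfl⟩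
    rw [← inner_embed]
    exact hb _ ⟨b, hbB, rfl⟩

theorem total_comp_embed (n : ℕ) : Tail.total ∘ₗ embed n = omega n :=
  LinearMap.ext total_embed

/-! ### Flags and words -/

namespace FlagVariety

variable {n : ℕ}

/-- The `i`-th term of a flag as a subspace of the tail module. -/
def tail (W : FlagVariety n) (i : Fin (2 * n + 1)) : Submodule ℂ Tail :=
  (W.subspace i).map (embed n)

instance (W : FlagVariety n) (i : Fin (2 * n + 1)) : FiniteDimensional ℂ (W.tail i) :=
  inferInstanceAs (FiniteDimensional ℂ ((W.subspace i).map (embed n)))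

theorem subspace_castSucc_lt (W : FlagVariety n) (i : Fin (2 * n)) :
    W.subspace i.castSucc < W.subspace i.succ := by
  have h := W.2.2.2 i
  exact lt_of_le_of_ne h.le fun e => h.ne (Submodule.restrictScalars_injective ℂ ℂ[X] (V n) e)

/-- Strictness bounds the dimension from below starting at 0 and from above starting at dim V(n) =
2n. -/
theorem finrank_subspace (W : FlagVariety n) (i : Fin (2 * n + 1)) :
    Module.finrank ℂ (W.subspace i) = i := by
  have step : ∀ i : Fin (2 * n), Module.finrank ℂ (W.subspace i.castSucc) + 1 ≤
      Module.finrank ℂ (W.subspace i.succ) := fun i =>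
    Submodule.finrank_lt_finrank_of_lt (W.subspace_castSucc_lt i)
  have lower : ∀ i : Fin (2 * n + 1), (i : ℕ) ≤ Module.finrank ℂ (W.subspace i) := by
    intro i
    induction i using Fin.induction with
    | zero => simp
    | succ i ih =>
      have := step i
      simp only [Fin.val_castSucc, Fin.val_succ] at *
      omega
  have upper : ∀ i : Fin (2 * n + 1), Module.finrank ℂ (W.subspace i) ≤ i := by
    intro i
    induction i using Fin.reverseInduction with
    | last =>
      have := (W.subspace (Fin.last (2 * n))).finrank_le
      rw [finrank_V] at this
      simpa using this
    | cast i ih =>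
      have := step i
      simp only [Fin.val_castSucc, Fin.val_succ] at *
      omega
  exact le_antisymm (upper i) (lower i)

theorem finrank_tail (W : FlagVariety n) (i : Fin (2 * n + 1)) :
    Module.finrank ℂ (W.tail i) = i := by
  rw [← W.finrank_subspace i]
  exact (Submodule.equivMapOfInjective _ (embed_injective n) _).finrank_eq.symm

theorem tail_le_preimage (W : FlagVariety n) (i : Fin (2 * n + 1)) :
    W.tail i ≤ Tail.preimage (W.tail i) := by
  rintro _ ⟨a, ha, rfl⟩
  rw [Tail.mem_preimage, ← embed_X_smul]
  exact ⟨_, (W.1 i).smul_mem X ha, rfl⟩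

theorem omegaLine_eq (W : FlagVariety n) (i : Fin (2 * n)) :
    omegaLine W i = (W.tail i.succ ⊓ (W.tail i.castSucc)ᗮ).map Tail.total := by
  rw [tail, tail, ← map_embed_inf_orthogonal, ← Submodule.map_comp, total_comp_embed]
  rfl

theorem next_omegaLine (W : FlagVariety n) (i : Fin (2 * n)) :
    Module.finrank ℂ (omegaLine W i) = 1 ∧
      Tail.next (W.tail i.castSucc) (omegaLine W i) = W.tail i.succ := by
  rw [omegaLine_eq]
  apply Tail.next_of_finrank (W.tail_le_preimage _) (W.tail_le_preimage _)
  · exact Submodule.map_mono (W.subspace_castSucc_lt i).le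
  · rw [finrank_tail, finrank_tail, Fin.val_succ, Fin.val_castSucc]

/-- The line `ω(Wᵢ ⊖ Wᵢ₋₁)` as a point of the projective line. -/
def line (W : FlagVariety n) (i : Fin (2 * n)) : CP1 :=
  Projectivization.mk'' (omegaLine W i) (W.next_omegaLine i).1

theorem submodule_line (W : FlagVariety n) (i : Fin (2 * n)) :
    (W.line i).submodule = omegaLine W i :=
  Projectivization.submodule_mk'' _ _

end FlagVariety

/-- The first `k` letters of a word, in reverse order. -/
def initialWord {m : ℕ} (u : Fin m → CP1) (k : ℕ) : List CP1 := ((List.ofFn u).take k).reverse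

theorem initialWord_succ {m : ℕ} (u : Fin m → CP1) (i : Fin m) :
    initialWord u (i + 1) = u i :: initialWord u i := by
  rw [initialWord, ← List.take_concat_get' (List.ofFn u) i (by simp), List.reverse_append]
  simp [initialWord]

theorem length_initialWord {m : ℕ} (u : Fin m → CP1) {k : ℕ} (hk : k ≤ m) :
    (initialWord u k).length = k := by
  simp [initialWord, hk]

theorem initialWord_self {m : ℕ} (u : Fin m → CP1) : initialWord u m = (List.ofFn u).reverse := by
  rw [initialWord, List.take_of_length_le (by simp)]

namespace FlagVariety

variable {n : ℕ}

theorem tail_eq_span (W : FlagVariety n) (i : Fin (2 * n + 1)) :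
    W.tail i = Tail.span (initialWord W.line i) := by
  induction i using Fin.induction with
  | zero =>
    have : W.subspace 0 = ⊥ := by
      rw [subspace, W.2.1]
      rfl
    rw [tail, this, Submodule.map_bot]
    rfl
  | succ i ih =>
    rw [Fin.val_succ, initialWord_succ, Tail.span, ← (W.next_omegaLine i).2, ih, submodule_line]
    rfl

theorem tail_last (W : FlagVariety n) : W.tail (Fin.last (2 * n)) = Tail.level n := by
  have : W.subspace (Fin.last (2 * n)) = ⊤ := by
    rw [subspace, W.2.2.1]
    rfl
  rw [tail, this, Submodule.map_top, range_embed]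

theorem line_mem_XPrime (W : FlagVariety n) : W.line ∈ XPrime n := by
  rw [mem_XPrime_iff_cancels]
  have h := W.tail_last
  rw [tail_eq_span, Fin.val_last, initialWord_self] at h
  simpa using (Tail.cancels_of_span h).reverse

theorem line_injective : Function.Injective (line : FlagVariety n → Fin (2 * n) → CP1) := by
  intro W W' h
  apply Subtype.ext
  funext i
  apply Submodule.restrictScalars_injective ℂ ℂ[X] (V n)
  apply Submodule.map_injective_of_injective (embed_injective n)
  change W.tail i = W'.tail i
  rw [tail_eq_span, tail_eq_span, h]

end FlagVariety

/-- The `ℂ[t]`-submodule of `V(n)` cut out by a shift-stable subspace of the tail module. -/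
def pullback (n : ℕ) (S : Submodule ℂ Tail) (hS : S ≤ Tail.preimage S) : Submodule ℂ[X] (V n) where
  toAddSubmonoid := (S.comap (embed n)).toAddSubmonoid
  smul_mem' p a ha := by
    change embed n (p • a) ∈ S
    have ha : embed n a ∈ S := ha
    induction p using Polynomial.induction_on' with
    | add p q hp hq =>
      rw [add_smul, map_add]
      exact S.add_mem hp hq
    | monomial k c =>
      rw [← C_mul_X_pow_eq_monomial, mul_smul, ← algebraMap_eq, algebraMap_smul, map_smul,
        embed_X_pow_smul]
      refine S.smul_mem c ?_
      induction k with
      | zero => exact ha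
      | succ k ih =>
        rw [pow_succ', Module.End.mul_apply]
        exact hS ih

theorem map_pullback {n : ℕ} {S : Submodule ℂ Tail} (hS : S ≤ Tail.preimage S)
    (h : S ≤ Tail.level n) :
    ((pullback n S hS).restrictScalars ℂ).map (embed n) = S := by
  rw [← range_embed] at h
  exact (Submodule.map_comap_eq _ _).trans (inf_eq_right.mpr h)

theorem span_initialWord_mono {m : ℕ} (u : Fin m → CP1) {i j : ℕ} (hij : i ≤ j) (hj : j ≤ m) :
    Tail.span (initialWord u i) ≤ Tail.span (initialWord u j) := by
  induction j, hij using Nat.le_induction with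
  | base => exact le_rfl
  | succ j hij ih =>
    have := initialWord_succ u ⟨j, hj⟩
    simp only at this
    rw [this]
    exact (ih (by omega)).trans (Tail.span_le_span_cons _ _)

namespace FlagVariety

variable {n : ℕ}

/-- The subspaces of the initial words form the flag. Cancellation makes the last one the range of
`embed n`, so all of them lie in that range and pulling back loses nothing. -/
theorem exists_line_eq {u : Fin (2 * n) → CP1} (hu : u ∈ XPrime n) :
    ∃ W : FlagVariety n, W.line = u := by
  have hc := (mem_XPrime_iff_cancels.mp hu).reverse
  rw [List.reverse_nil, ← initialWord_self] at hc
  have htop := Tail.span_of_cancels hc (n := n) (length_initialWord u le_rfl)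
  let S : Fin (2 * n + 1) → Submodule ℂ Tail := fun i => Tail.span (initialWord u i)
  have hS : ∀ i, S i ≤ Tail.preimage (S i) := fun i => Tail.span_le_preimage _
  have hlevel : ∀ i, S i ≤ Tail.level n := fun i => by
    rw [← htop]
    exact span_initialWord_mono u (by omega) le_rfl
  have hmap : ∀ i, ((pullback n (S i) (hS i)).restrictScalars ℂ).map (embed n) = S i :=
    fun i => map_pullback (hS i) (hlevel i)
  have hle : ∀ i : Fin (2 * n), S i.castSucc ≤ S i.succ := fun i =>
    span_initialWord_mono u (by simp) (by simp only [Fin.val_succ]; omega)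
  let W : FlagVariety n := ⟨fun i => pullback n (S i) (hS i), by
    refine (Submodule.eq_bot_iff _).mpr fun a ha => embed_injective n ?_
    rw [map_zero]
    exact ha, by
    refine (Submodule.eq_top_iff'.mpr fun a => ?_)
    change embed n a ∈ Tail.span (initialWord u (2 * n))
    rw [htop, ← range_embed]
    exact ⟨a, rfl⟩, by
    intro i
    refine lt_of_le_of_ne (fun a ha => hle i ha) fun e => ?_
    have e : pullback n (S i.castSucc) (hS _) = pullback n (S i.succ) (hS _) := e
    have h := hmap i.castSucc
    rw [e, hmap] at h
    have h := congrArg (fun T : Submodule ℂ Tail => Module.finrank ℂ T) h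
    simp only [S, Tail.finrank_span] at h
    rw [length_initialWord, length_initialWord] at h
    · simp at h
    · simp only [Fin.val_castSucc]; omega
    · simp only [Fin.val_succ]; omega⟩
  refine ⟨W, funext fun i => Projectivization.submodule_injective ?_⟩
  have htail : ∀ i, W.tail i = S i := hmap
  rw [submodule_line, omegaLine_eq, htail, htail]
  change Submodule.map _ (Tail.span (initialWord u (i + 1)) ⊓ _) = _
  rw [initialWord_succ]
  exact Tail.map_total_next (Tail.span_le_preimage _) _

end FlagVariety

/-! ### The topology of the projective line -/

theorem continuous_mk :
    Continuous fun v : {v : C2 // v ≠ 0} => (Projectivization.mk ℂ v.1 v.2 : CP1) :=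
  continuous_quotient_mk' (s := projectivizationSetoid ℂ C2)

theorem continuous_CP1_iff {Z : Type*} [TopologicalSpace Z] {f : CP1 → Z} :
    Continuous f ↔ Continuous fun v : {v : C2 // v ≠ 0} => f (Projectivization.mk ℂ v.1 v.2) :=
  (isQuotientMap_quotient_mk' (s := projectivizationSetoid ℂ C2)).continuous_iff

instance : T2Space CP1 := by
  -- Sending a line to its orthogonal projection, evaluated pointwise, is a continuous injection
  -- into a Hausdorff space.
  let f : CP1 → C2 → C2 := fun L w => L.submodule.starProjection w
  have hinj : Function.Injective f := by
    intro L L' h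
    apply Projectivization.submodule_injective
    ext w
    rw [← Submodule.starProjection_eq_self_iff, ← Submodule.starProjection_eq_self_iff]
    change f L w = w ↔ f L' w = w
    rw [h]
  refine T2Space.of_injective_continuous hinj ?_
  rw [continuous_CP1_iff]
  refine continuous_pi fun w => ?_
  simp only [f, Projectivization.submodule_mk, Submodule.starProjection_singleton]
  have h1 : Continuous fun v : {v : C2 // v ≠ 0} => inner ℂ v.1 w := by fun_prop
  have h2 : Continuous fun v : {v : C2 // v ≠ 0} => ((‖v.1‖ ^ 2 : ℝ) : ℂ) := by fun_prop
  exact (h1.div h2 fun v => by simpa using v.2).smul continuous_subtype_val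

/-- A vector orthogonal to `v`, depending continuously on `v`. -/
def perp (v : C2) : C2 := !₂[-starRingEnd ℂ (v 1), starRingEnd ℂ (v 0)]

theorem inner_perp (v : C2) : inner ℂ v (perp v) = 0 := by
  simp [perp, PiLp.inner_apply, Fin.sum_univ_two]
  ring

theorem perp_ne_zero {v : C2} (hv : v ≠ 0) : perp v ≠ 0 := by
  intro h
  apply hv
  ext i
  have h0 := congrArg (fun w : C2 => w 0) h
  have h1 := congrArg (fun w : C2 => w 1) h
  simp [perp] at h0 h1
  fin_cases i
  · exact h1
  · exact h0

theorem chi_mk {v : C2} (hv : v ≠ 0) :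
    chi (Projectivization.mk ℂ v hv) = Projectivization.mk ℂ (perp v) (perp_ne_zero hv) := by
  apply Projectivization.submodule_injective
  symm
  apply Submodule.eq_of_le_of_finrank_eq
  · rw [submodule_chi, Projectivization.submodule_mk, Projectivization.submodule_mk,
      Submodule.span_singleton_le_iff_mem, Submodule.mem_orthogonal_singleton_iff_inner_right]
    exact inner_perp v
  · rw [Projectivization.finrank_submodule, Projectivization.finrank_submodule]

theorem continuous_chi : Continuous chi := by
  rw [continuous_CP1_iff]
  simp only [chi_mk]
  have h : Continuous fun v : {v : C2 // v ≠ 0} =>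
      (⟨perp v.1, perp_ne_zero v.2⟩ : {v : C2 // v ≠ 0}) := by
    refine Continuous.subtype_mk ?_ _
    unfold perp
    refine (PiLp.continuous_toLp 2 _).comp (continuous_pi fun i => ?_)
    fin_cases i
    · simp only [Fin.zero_eta, Matrix.cons_val_zero]
      fun_prop
    · simp only [Fin.mk_one, Matrix.cons_val_one, Matrix.cons_val_fin_one]
      fun_prop
  exact continuous_mk.comp h

/-! ### Continuity of the lines of a flag -/

instance (n : ℕ) : CompleteSpace (V n) := FiniteDimensional.complete ℂ (V n)

namespace FlagVariety

variable {n : ℕ}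

/-- The orthogonal projections onto the terms of a flag. -/
def proj (W : FlagVariety n) (i : Fin (2 * n + 1)) : V n →L[ℂ] V n := (W.subspace i).starProjection

theorem isInducing_proj : Topology.IsInducing (proj : FlagVariety n → _) := ⟨rfl⟩

theorem continuous_proj : Continuous (proj : FlagVariety n → _) := isInducing_proj.continuous

/-- For nested subspaces the difference of the projections is the projection onto the relative
orthogonal complement. -/
theorem proj_sub_apply_mem (W : FlagVariety n) (i : Fin (2 * n)) (v : V n) :
    (W.proj i.succ - W.proj i.castSucc) v ∈ W.subspace i.succ ⊓ (W.subspace i.castSucc)ᗮ := by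
  have hle := (W.subspace_castSucc_lt i).le
  have e : (W.proj i.succ - W.proj i.castSucc) v =
      W.proj i.succ v - W.proj i.castSucc (W.proj i.succ v) := by
    have := congrArg (fun f : V n →L[ℂ] V n => f v)
      (Submodule.starProjection_comp_starProjection_of_le hle)
    change W.proj i.castSucc (W.proj i.succ v) = W.proj i.castSucc v at this
    rw [this]
    rfl
  rw [e]
  refine ⟨Submodule.sub_mem _ ?_ (hle ?_), Submodule.sub_starProjection_mem_orthogonal _⟩
  · exact Submodule.starProjection_apply_mem _ _
  · exact Submodule.starProjection_apply_mem _ _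

theorem proj_sub_apply_of_mem (W : FlagVariety n) (i : Fin (2 * n)) {v : V n}
    (hv : v ∈ W.subspace i.succ ⊓ (W.subspace i.castSucc)ᗮ) :
    (W.proj i.succ - W.proj i.castSucc) v = v := by
  have h1 : W.proj i.succ v = v := Submodule.starProjection_eq_self_iff.mpr hv.1
  have h2 : W.proj i.castSucc v = 0 := (Submodule.starProjection_apply_eq_zero_iff _).mpr hv.2
  rw [sub_apply, h1, h2, sub_zero]

theorem exists_omega_ne_zero (W : FlagVariety n) (i : Fin (2 * n)) :
    ∃ v ∈ W.subspace i.succ ⊓ (W.subspace i.castSucc)ᗮ, omega n v ≠ 0 := by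
  have h := (W.next_omegaLine i).1
  have hne : omegaLine W i ≠ ⊥ := by
    intro e
    rw [e, finrank_bot] at h
    exact zero_ne_one h
  obtain ⟨_, ⟨v, hv, rfl⟩, hy⟩ := Submodule.exists_mem_ne_zero_of_ne_bot hne
  exact ⟨v, hv, hy⟩

theorem line_eq_mk (W : FlagVariety n) (i : Fin (2 * n)) {y : C2} (hy : y ≠ 0)
    (h : y ∈ omegaLine W i) : W.line i = Projectivization.mk ℂ y hy := by
  apply Projectivization.submodule_injective
  symm
  apply Submodule.eq_of_le_of_finrank_eq
  · rwa [submodule_line, Projectivization.submodule_mk, Submodule.span_singleton_le_iff_mem]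
  · rw [Projectivization.finrank_submodule, Projectivization.finrank_submodule]

theorem continuous_line : Continuous (line : FlagVariety n → Fin (2 * n) → CP1) := by
  refine continuous_pi fun i => continuous_iff_continuousAt.mpr fun W₀ => ?_
  obtain ⟨v, hv, hv0⟩ := W₀.exists_omega_ne_zero i
  -- With v fixed, this vector lies in the i-th line of every W and is nonzero near W₀, so it is a
  -- local continuous lift of the line to ℂ² ∖ {0}.
  let f : FlagVariety n → C2 := fun W => omega n ((W.proj i.succ - W.proj i.castSucc) v)
  have hf : Continuous f := by
    have hω : Continuous (omega n) := (omega n).continuous_of_finiteDimensional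
    have h1 : ∀ j, Continuous fun W : FlagVariety n => W.proj j :=
      fun j => (continuous_apply j).comp continuous_proj
    exact hω.comp (((h1 _).sub (h1 _)).clm_apply continuous_const)
  have hU : IsOpen {W | f W ≠ 0} := isOpen_ne_fun hf continuous_const
  have hmem : f W₀ ≠ 0 := by
    simp only [f]
    rwa [proj_sub_apply_of_mem _ _ hv]
  refine (hU.isOpenEmbedding_subtypeVal.continuousAt_iff (x := ⟨W₀, hmem⟩)).mp ?_
  have he : (fun W : FlagVariety n => W.line i) ∘ (Subtype.val : {W | f W ≠ 0} → _) =
      fun W => Projectivization.mk ℂ (f W.1) W.2 :=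
    funext fun W => W.1.line_eq_mk i W.2 ⟨_, W.1.proj_sub_apply_mem i v, rfl⟩
  rw [he]
  have hc : Continuous fun W : {W | f W ≠ 0} => (⟨f W.1, W.2⟩ : {v : C2 // v ≠ 0}) :=
    (hf.comp continuous_subtype_val).subtype_mk _
  exact (continuous_mk.comp hc).continuousAt

/-! ### Compactness of the flag variety -/

/-- Multiplication by `t` as a continuous linear map. -/
def mulX (n : ℕ) : V n →L[ℂ] V n :=
  LinearMap.toContinuousLinearMap
    { toFun := fun a => (X : ℂ[X]) • a
      map_add' := smul_add _
      map_smul' := fun c a => smul_comm _ c a }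

/-- The conditions characterising the families of projections that come from flags. -/
def projections (n : ℕ) : Set (Fin (2 * n + 1) → V n →L[ℂ] V n) :=
  {P | (∀ i, P i * P i = P i ∧ star (P i) = P i ∧ P i * mulX n * P i = mulX n * P i) ∧
    P 0 = 0 ∧ P (Fin.last (2 * n)) = 1 ∧
    -- The norm bound is a closed form of strict inclusion: a difference of nested projections is a
    -- projection, of norm at least 1 unless it vanishes.
    ∀ i : Fin (2 * n), P i.succ * P i.castSucc = P i.castSucc ∧
      1 ≤ ‖P i.succ - P i.castSucc‖}

theorem isClosed_projections : IsClosed (projections n) := by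
  have hP : ∀ i, Continuous fun P : Fin (2 * n + 1) → V n →L[ℂ] V n => P i := continuous_apply
  simp only [projections, Set.ofPred_and, Set.ofPred_forall]
  refine IsClosed.inter ?_ (IsClosed.inter ?_ (IsClosed.inter ?_ ?_))
  · refine isClosed_iInter fun i => IsClosed.inter ?_ (IsClosed.inter ?_ ?_)
    · exact isClosed_eq ((hP i).mul (hP i)) (hP i)
    · exact isClosed_eq (hP i).star (hP i)
    · exact isClosed_eq (((hP i).mul continuous_const).mul (hP i)) (continuous_const.mul (hP i))
  · exact isClosed_eq (hP _) continuous_const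
  · exact isClosed_eq (hP _) continuous_const
  · refine isClosed_iInter fun i => IsClosed.inter ?_ ?_
    · exact isClosed_eq ((hP _).mul (hP _)) (hP _)
    · exact isClosed_le continuous_const ((hP _).sub (hP _)).norm

theorem proj_mem_projections (W : FlagVariety n) : W.proj ∈ projections n := by
  have hs : ∀ i, IsStarProjection (W.proj i) := fun i => isStarProjection_starProjection
  refine ⟨fun i => ⟨(hs i).isIdempotentElem, (hs i).isSelfAdjoint, ?_⟩, ?_, ?_, fun i => ⟨?_, ?_⟩⟩
  · ext1 a
    refine Submodule.starProjection_eq_self_iff.mpr ?_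
    exact (W.1 i).smul_mem X (Submodule.starProjection_apply_mem (W.subspace i) a)
  · ext1 a
    refine (Submodule.starProjection_apply_eq_zero_iff _).mpr fun b hb => ?_
    have hb : b ∈ W.1 0 := hb
    rw [W.2.1, Submodule.mem_bot] at hb
    rw [hb, inner_zero_left]
  · ext1 a
    refine Submodule.starProjection_eq_self_iff.mpr ?_
    change a ∈ W.1 _
    rw [W.2.2.1]
    exact Submodule.mem_top
  · ext1 a
    refine Submodule.starProjection_eq_self_iff.mpr ?_
    exact (W.subspace_castSucc_lt i).le (Submodule.starProjection_apply_mem _ a)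
  · obtain ⟨v, hv, hv0⟩ := W.exists_omega_ne_zero i
    have hpos : 0 < ‖v‖ := norm_pos_iff.mpr fun e => hv0 (by rw [e, map_zero])
    have h := (W.proj i.succ - W.proj i.castSucc).le_opNorm v
    rw [proj_sub_apply_of_mem _ _ hv] at h
    exact le_of_mul_le_mul_right (by rwa [one_mul]) hpos

theorem exists_restrictScalars_eq {U : Submodule ℂ (V n)} (h : ∀ a ∈ U, (X : ℂ[X]) • a ∈ U) :
    ∃ M : Submodule ℂ[X] (V n), M.restrictScalars ℂ = U := by
  have hS : U.map (embed n) ≤ Tail.preimage (U.map (embed n)) := by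
    rintro _ ⟨a, ha, rfl⟩
    exact ⟨_, h a ha, embed_X_smul a⟩
  refine ⟨pullback n _ hS, Submodule.map_injective_of_injective (embed_injective n) ?_⟩
  rw [map_pullback hS]
  rw [← range_embed]
  exact LinearMap.map_le_range

theorem exists_proj_eq {P : Fin (2 * n + 1) → V n →L[ℂ] V n} (hP : P ∈ projections n) :
    ∃ W : FlagVariety n, W.proj = P := by
  obtain ⟨h1, h2, h3, h4⟩ := hP
  have hK : ∀ i, ∃ M : Submodule ℂ[X] (V n), P i = (M.restrictScalars ℂ).starProjection := by
    intro i
    obtain ⟨K, hK, e⟩ := isStarProjection_iff_eq_starProjection.mp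
      (⟨(h1 i).1, (h1 i).2.1⟩ : IsStarProjection (P i))
    have hX : ∀ a ∈ K, (X : ℂ[X]) • a ∈ K := by
      intro a ha
      rw [← Submodule.starProjection_eq_self_iff, ← e] at ha ⊢
      have := congrArg (fun f : V n →L[ℂ] V n => f a) (h1 i).2.2
      change P i ((X : ℂ[X]) • P i a) = (X : ℂ[X]) • P i a at this
      rwa [ha] at this
    obtain ⟨M, rfl⟩ := exists_restrictScalars_eq hX
    exact ⟨M, e⟩
  choose M hM using hK
  have hmem : ∀ i a, a ∈ M i ↔ P i a = a := by
    intro i a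
    rw [hM i, Submodule.starProjection_eq_self_iff]
    rfl
  refine ⟨⟨M, ?_, ?_, fun i => lt_of_le_of_ne (fun a ha => ?_) fun e => ?_⟩,
    funext fun i => (hM i).symm⟩
  · refine (Submodule.eq_bot_iff _).mpr fun a ha => ?_
    rw [hmem, h2] at ha
    exact ha.symm
  · refine Submodule.eq_top_iff'.mpr fun a => ?_
    rw [hmem, h3]
    rfl
  · rw [hmem] at ha ⊢
    have := congrArg (fun f : V n →L[ℂ] V n => f a) (h4 i).1
    change P i.succ (P i.castSucc a) = P i.castSucc a at this
    rwa [ha] at this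
  · have h := (h4 i).2
    have e' : P i.succ = P i.castSucc := by
      rw [hM, hM]
      simp only [e]
    rw [e', sub_self, norm_zero] at h
    exact absurd h (by norm_num)

/-- The projections identify the flags with a closed subset of the unit ball of a finite-dimensional
space. -/
instance : CompactSpace (FlagVariety n) := by
  have hr : Set.range (proj : FlagVariety n → _) = projections n := by
    ext P
    exact ⟨fun ⟨W, hW⟩ => hW ▸ W.proj_mem_projections, fun hP => exists_proj_eq hP⟩
  rw [← isCompact_univ_iff, isInducing_proj.isCompact_iff, Set.image_univ, hr]
  have : ProperSpace (V n →L[ℂ] V n) := FiniteDimensional.proper ℂ _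
  refine (isCompact_closedBall (0 : Fin (2 * n + 1) → V n →L[ℂ] V n) 1).of_isClosed_subset
    isClosed_projections ?_
  rw [← hr]
  rintro _ ⟨W, rfl⟩
  rw [mem_closedBall_zero_iff, pi_norm_le_iff_of_nonneg zero_le_one]
  exact fun i => Submodule.starProjection_norm_le _

/-! ### The homeomorphisms -/

/-- The homeomorphism between flags and antipodally matched words. -/
def homeomorphXPrime (n : ℕ) : FlagVariety n ≃ₜ XPrime n :=
  Continuous.homeoOfEquivCompactToT2
    (f := Equiv.ofBijective (fun W => (⟨W.line, W.line_mem_XPrime⟩ : XPrime n))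
      ⟨fun _ _ h => line_injective (congrArg Subtype.val h), fun u =>
        (exists_line_eq u.2).imp fun _ h => Subtype.ext h⟩)
    (continuous_line.subtype_mk _)

end FlagVariety

/-- The restriction of a labelling of the polygon to the positively oriented edges. -/
def restrictEdges {n : ℕ} (m : Y (polygon n)) : XPrime n :=
  ⟨fun i => m.1 (polygonEdge n i), mem_XPrime_of_mem_Y m.2⟩

theorem restrictEdges_bijective {n : ℕ} (hn : 0 < n) :
    Function.Bijective (restrictEdges : Y (polygon n) → XPrime n) := by
  constructor
  · intro m m' h
    have he : ∀ i, m.1 (polygonEdge n i) = m'.1 (polygonEdge n i) := fun i =>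
      congrFun (congrArg Subtype.val h) i
    apply Subtype.ext
    funext d
    obtain ⟨i, rfl | rfl⟩ := exists_polygonEdge hn d
    · exact he i
    · rw [Y_subset_Y1 _ m.2, Y_subset_Y1 _ m'.2, he]
  · intro u
    obtain ⟨m, hm, hmu⟩ := exists_mem_Y hn u.2
    exact ⟨⟨m, hm⟩, Subtype.ext (funext hmu)⟩

/-- The homeomorphism between tree-foldable labellings of the polygon and matched words. -/
def homeomorphY {n : ℕ} (hn : 0 < n) : Y (polygon n) ≃ₜ XPrime n where
  toEquiv := Equiv.ofBijective restrictEdges (restrictEdges_bijective hn)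
  continuous_toFun := continuous_induced_rng.mpr (continuous_pi fun i =>
    (continuous_apply (polygonEdge n i)).comp continuous_subtype_val)
  continuous_invFun := by
    set e := Equiv.ofBijective restrictEdges (restrictEdges_bijective hn)
    have he : ∀ u i, (e.symm u).1 (polygonEdge n i) = u.1 i := fun u i =>
      congrFun (congrArg Subtype.val (e.apply_symm_apply u)) i
    refine continuous_induced_rng.mpr (continuous_pi fun d => ?_)
    have hu : ∀ i, Continuous fun u : XPrime n => u.1 i := fun i =>
      (continuous_apply i).comp continuous_subtype_val
    -- Each coordinate of the inverse is `u i` or `chi (u i)`.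
    obtain ⟨i, rfl | rfl⟩ := exists_polygonEdge hn d
    · exact (hu i).congr fun u => (he u i).symm
    · refine (continuous_chi.comp (hu i)).congr fun u => ?_
      change _ = (e.symm u).1 (polygonEdge n i).symm
      rw [Y_subset_Y1 _ (e.symm u).2, he]
      rfl

end KhovanovSpringer

end

open KhovanovSpringer in
theorem mainTheorem3 (n : ℕ) :
    ∃ omegaBar : FlagVariety n → Fin (2 * n) → CP1,
      (∀ W i, (omegaBar W i).submodule = omegaLine W i) ∧
      (∃ h : FlagVariety n ≃ₜ XPrime n, ∀ W i, (h W : Fin (2 * n) → CP1) i = omegaBar W i) ∧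
      (0 < n → ∃ σ : FlagVariety n ≃ₜ Y (polygon n), ∀ W i,
        (σ W : (polygon n).graph.Dart → CP1) (polygonEdge n i) = omegaBar W i ∧
        (σ W : (polygon n).graph.Dart → CP1) (polygonEdge n i).symm = chi (omegaBar W i)) := by
  refine ⟨FlagVariety.line, FlagVariety.submodule_line,
    ⟨FlagVariety.homeomorphXPrime n, fun W i => rfl⟩, fun hn => ?_⟩
  refine ⟨(FlagVariety.homeomorphXPrime n).trans (homeomorphY hn).symm, fun W i => ?_⟩
  set m := (homeomorphY hn).symm (FlagVariety.homeomorphXPrime n W) with hm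
  have h : m.1 (polygonEdge n i) = W.line i := by
    have : restrictEdges m = FlagVariety.homeomorphXPrime n W :=
      (homeomorphY hn).apply_symm_apply _
    exact congrFun (congrArg Subtype.val this) i
  refine ⟨h, ?_⟩
  change m.1 (polygonEdge n i).symm = _
  rw [Y_subset_Y1 _ m.2, h]
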